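/- Let $k\ge 0$, let $\beta_0,\dots,\beta_k$ be algebraic numbers with $\beta_m\neq 0$ for some $m\ge 1$, and put $$f(z)=\sum_{m=0}^{k}\bigl(\beta_m z^m+\overline{\beta_m}\,\overline{z}^{\,m}\bigr)\quad(z\in\mathbb C),\qquad g(x)=f(e^{ix})\quad(x\in\mathbb R).$$ The function $f$ is given by the list of standard representations $(p,a,b,r)\in\mathbb Z[x]\times\mathbb Q^3$ of $\beta_0,\dots,\beta_k$: here $p$ is a defining polynomial of the number (an integer polynomial of least degree, with coprime coefficients, vanishing at it; list of coefficients in binary), and the number is the only root of $p$ in the open disc of radius $r$ around $a+bi$. Let $\|f\|$ be the bit length of this description. For a zero $\varphi$ of $g$ let $d\ge 1$ be the least integer with $g^{(d)}(\varphi)\ne 0$ and let $T_\varphi(x)=\frac{g^{(d)}(\varphi)}{d!}(x-\varphi)^d$ be the first nonvanishing Taylor term of $g$ at $\varphi$. Fix $D\in\mathbb N$. There is an algorithm that, given the description of such an $f$ with $[\mathbb Q(\beta_0,\dots,\beta_k):\mathbb Q]\le D$, computes in time polynomial in $\|f\|$ a rational number $\epsilon_1>0$ with $\frac1{\epsilon_1}\le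 2^{\|f\|^{O(1)}}$ such that for every zero $\varphi\in(-\pi,\pi]$ of $g$: 1. the sign of $g'$ does not change in $(\varphi,\varphi+\epsilon_1)$, nor in $(\varphi-\epsilon_1,\varphi)$; 2. $|g(x)-T_\varphi(x)|\le\frac12|T_\varphi(x)|$ for every $x\in(\varphi-\epsilon_1,\varphi+\epsilon_1)$; 3. $\operatorname{sign} g'(x)=\operatorname{sign} T_\varphi'(x)$ for every $x\in(\varphi-\epsilon_1,\varphi+\epsilon_1)$; and moreover $(\varphi-\epsilon_1,\varphi+\epsilon_1)\subseteq(-\pi,\pi)$ if $\varphi\neq\pi$. (The degree of the time bound and the constant in $O(1)$ may depend on $D$ only.) -/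

import Mathlib

noncomputable section

namespace DominantFunction

/-! ### Standard representations of algebraic numbers and their binary encodings -/

/-- Data `(p, a, b, r) ∈ ℤ[x] × ℚ³` intended to describe an algebraic number: a polynomial `p`
and the disc of radius `r` centred at `a + b i`. -/
structure AlgRep where
  poly : Polynomial ℤ
  re : ℚ
  im : ℚ
  rad : ℚ

/-- `p` is a defining polynomial of `α`: it vanishes at `α`, has coprime coefficients, and has
least degree among the nonzero integer polynomials vanishing at `α`. (This determines `p` up to
sign; both signs are admitted.) -/
def IsDefiningPoly (p : Polynomial ℤ) (α : ℂ) : Prop :=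
  p ≠ 0 ∧ p.IsPrimitive ∧ Polynomial.aeval α p = 0 ∧
    ∀ q : Polynomial ℤ, q ≠ 0 → Polynomial.aeval α q = 0 → p.natDegree ≤ q.natDegree

/-- The centre `a + b i` of the isolating disc. -/
def AlgRep.centre (R : AlgRep) : ℂ := (R.re : ℂ) + (R.im : ℂ) * Complex.I

/-- `R = (p, a, b, r)` is a standard representation of `α`: `p` is the defining polynomial of `α`
and `α` is the unique root of `p` inside the circle of radius `r` centred at `a + b i`. -/
def AlgRep.Represents (R : AlgRep) (α : ℂ) : Prop :=
  IsDefiningPoly R.poly α ∧ ‖α - R.centre‖ < (R.rad : ℝ) ∧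
    ∀ z : ℂ, Polynomial.aeval z R.poly = 0 → ‖z - R.centre‖ < (R.rad : ℝ) → z = α

/-- The two-bit code of a binary digit. The first bit `true` distinguishes digits from the
punctuation marks `comma` and `semicolon`. -/
def digit (b : Bool) : List Bool := [true, b]

/-- Two-bit code of the mark that closes an integer. -/
def comma : List Bool := [false, false]

/-- Two-bit code of the mark that closes a list of integers. -/
def semicolon : List Bool := [false, true]

/-- An integer: a sign digit, the binary digits of the absolute value, a comma. -/
def encodeInt (z : ℤ) : List Bool :=
  digit (decide (z < 0)) ++ (Computability.encodeNat z.natAbs).flatMap digit ++ comma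

/-- A rational number in lowest terms: numerator, then denominator, in binary. -/
def encodeRat (q : ℚ) : List Bool := encodeInt q.num ++ encodeInt (q.den : ℤ)

/-- An integer polynomial: the list of its coefficients, from degree `0` to its degree, in
binary. -/
def encodePoly (p : Polynomial ℤ) : List Bool :=
  (List.range (p.natDegree + 1)).flatMap (fun i => encodeInt (p.coeff i)) ++ semicolon

/-- The tuple `(p, a, b, r)` as a bit string. -/
def encodeAlgRep (R : AlgRep) : List Bool :=
  encodePoly R.poly ++ encodeRat R.re ++ encodeRat R.im ++ encodeRat R.rad

/-- Description of a dominant function: representations of its coefficients `β₀, …, β_k`. -/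
structure FunRep where
  k : ℕ
  coeff : Fin (k + 1) → AlgRep

/-- The description of a dominant function as a bit string. -/
def encodeFun (F : FunRep) : List Bool := (List.ofFn F.coeff).flatMap encodeAlgRep

/-- The encoding length `‖f‖`, in bits. -/
def FunRep.size (F : FunRep) : ℕ := (encodeFun F).length

/-! ### The dominant function and its Taylor terms -/

/-- The dominant function `f(z) = ∑_{m=0}^k (β_m z^m + conj β_m * conj z^m)`, a real number since
each summand is the sum of a complex number and its conjugate. -/
def dominant {k : ℕ} (β : Fin (k + 1) → ℂ) (z : ℂ) : ℝ :=
  (∑ m : Fin (k + 1), (β m * z ^ (m : ℕ) +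
    (starRingEnd ℂ) (β m) * ((starRingEnd ℂ) z) ^ (m : ℕ))).re

/-- Taking the real part in `dominant` loses nothing. -/
theorem coe_dominant {k : ℕ} (β : Fin (k + 1) → ℂ) (z : ℂ) :
    (dominant β z : ℂ) = ∑ m : Fin (k + 1), (β m * z ^ (m : ℕ) +
      (starRingEnd ℂ) (β m) * ((starRingEnd ℂ) z) ^ (m : ℕ)) := by
  unfold dominant
  rw [← Complex.conj_eq_iff_re, map_sum]
  refine Finset.sum_congr rfl fun m _ => ?_
  simp [add_comm]

/-- `g(x) = f(e^{ix})`, extended naturally from `(-π, π]` to the whole real line. -/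
def circleFun {k : ℕ} (β : Fin (k + 1) → ℂ) (x : ℝ) : ℝ :=
  dominant β (Complex.exp ((x : ℂ) * Complex.I))

/-- The least `d` such that the `d`-th derivative of `g` at `φ` does not vanish. -/
def firstOrder (g : ℝ → ℝ) (φ : ℝ) : ℕ := sInf {d : ℕ | iteratedDeriv d g φ ≠ 0}

/-- The first nonvanishing Taylor term `T(x) = g^{(d)}(φ) / d! * (x - φ)^d` of `g` at `φ`. -/
def firstTaylor (g : ℝ → ℝ) (φ : ℝ) (x : ℝ) : ℝ :=
  iteratedDeriv (firstOrder g φ) g φ / ((firstOrder g φ).factorial : ℝ) *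
    (x - φ) ^ firstOrder g φ

/-- The requirements on a radius `ε` at a point `φ`. -/
structure GoodRadius (g : ℝ → ℝ) (φ ε : ℝ) : Prop where
  /-- The sign of `g'` does not change in `(φ, φ + ε)`. -/
  sign_right : ∀ x ∈ Set.Ioo φ (φ + ε), ∀ y ∈ Set.Ioo φ (φ + ε),
    SignType.sign (deriv g x) = SignType.sign (deriv g y)
  /-- The sign of `g'` does not change in `(φ - ε, φ)`. -/
  sign_left : ∀ x ∈ Set.Ioo (φ - ε) φ, ∀ y ∈ Set.Ioo (φ - ε) φ,
    SignType.sign (deriv g x) = SignType.sign (deriv g y)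
  /-- `|g - T| ≤ |T| / 2` in `(φ - ε, φ + ε)`. -/
  approx : ∀ x ∈ Set.Ioo (φ - ε) (φ + ε),
    |g x - firstTaylor g φ x| ≤ 1 / 2 * |firstTaylor g φ x|
  /-- `g'` and `T'` have the same sign in `(φ - ε, φ + ε)`. -/
  sign_deriv : ∀ x ∈ Set.Ioo (φ - ε) (φ + ε),
    SignType.sign (deriv g x) = SignType.sign (deriv (firstTaylor g φ) x)

end DominantFunction

end

namespace DominantFunction

/-! ### A machine writing `2 ^ (-N ^ C)` on inputs of length `N` -/

section Machine

open Turing TM2.Stmt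

/-- `RunsIn M a b n`: the machine `M` gets from `a` to `b` in `n` steps. -/
def RunsIn {K Λ σ : Type} {Γ : K → Type} [DecidableEq K] (M : Λ → TM2.Stmt Γ Λ σ)
    (a b : TM2.Cfg Γ Λ σ) (n : ℕ) : Prop :=
  (flip bind (TM2.step M))^[n] (some a) = some b

theorem RunsIn.trans {K Λ σ : Type} {Γ : K → Type} [DecidableEq K] {M : Λ → TM2.Stmt Γ Λ σ}
    {a b c : TM2.Cfg Γ Λ σ} {m n : ℕ} (h₁ : RunsIn M a b m) (h₂ : RunsIn M b c n) :
    RunsIn M a c (m + n) := by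
  unfold RunsIn at *
  rw [add_comm, Function.iterate_add_apply, h₁, h₂]

theorem RunsIn.of_step {K Λ σ : Type} {Γ : K → Type} [DecidableEq K] {M : Λ → TM2.Stmt Γ Λ σ}
    {a b : TM2.Cfg Γ Λ σ} (h : TM2.step M a = some b) : RunsIn M a b 1 := h

theorem RunsIn.congr {K Λ σ : Type} {Γ : K → Type} [DecidableEq K] {M : Λ → TM2.Stmt Γ Λ σ}
    {a b b' : TM2.Cfg Γ Λ σ} {n n' : ℕ} (h : RunsIn M a b n) (hb : b = b') (hn : n = n') :
    RunsIn M a b' n' := hb ▸ hn ▸ h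

/-- Push the given symbols on a stack, the last symbol of the list ending on top. -/
def pushAll {K Λ σ : Type} (k : K) : List Bool → TM2.Stmt (fun _ : K => Bool) Λ σ →
    TM2.Stmt (fun _ : K => Bool) Λ σ
  | [], q => q
  | b :: l, q => push k (fun _ => b) (pushAll k l q)

/-- Pop from `k`; go on with `q₁` if the stack was nonempty and with `q₂` otherwise. -/
def popBranch {K Λ : Type} (k : K) (q₁ q₂ : TM2.Stmt (fun _ : K => Bool) Λ Bool) :
    TM2.Stmt (fun _ : K => Bool) Λ Bool :=
  pop k (fun _ o => o.isSome) (branch id q₁ q₂)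

/-- The program. Stack `0` holds the input, stack `1` is a buffer for it, stack `2` holds a unary
number, stack `3` its multiple under construction, and stack `4` is the output. The first component
of a label is the number of multiplications by the input length that are left to do. -/
def powProgram (C : ℕ) : Fin (C + 1) × Fin 7 →
    TM2.Stmt (fun _ : Fin 5 => Bool) (Fin (C + 1) × Fin 7) Bool
  | (i, 0) => push 2 (fun _ => true) (goto fun _ => (i, 1))
  | (i, 1) =>
    if i = 0 then goto fun _ => (i, 5) else
      popBranch 2 (goto fun _ => (i, 2)) (goto fun _ => (i, 4))
  | (i, 2) =>
    popBranch 0 (push 1 (fun _ => true) (push 3 (fun _ => true) (goto fun _ => (i, 2))))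
      (goto fun _ => (i, 3))
  | (i, 3) => popBranch 1 (push 0 (fun _ => true) (goto fun _ => (i, 3))) (goto fun _ => (i, 1))
  | (i, 4) => popBranch 3 (push 2 (fun _ => true) (goto fun _ => (i, 4)))
      (goto fun _ => (i - 1, 1))
  | (i, 5) => popBranch 0 (goto fun _ => (i, 5))
      (pushAll 4 [false, false, true, true] (goto fun _ => (i, 6)))
  | (i, 6) => popBranch 2 (pushAll 4 [false, true] (goto fun _ => (i, 6)))
      (pushAll 4 [false, true, false, false, true, true, false, true] halt)

/-- The machine with program `powProgram C`. -/
def powMachine (C : ℕ) : FinTM2 where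
  K := Fin 5
  k₀ := 0
  k₁ := 4
  Γ _ := Bool
  Λ := Fin (C + 1) × Fin 7
  main := (Fin.last C, 0)
  σ := Bool
  initialState := false
  Γk₀Fin := inferInstanceAs (Fintype Bool)
  m := powProgram C

/-- A configuration of `powMachine` given by its five stacks. -/
def powCfg {C : ℕ} (l : Option (Fin (C + 1) × Fin 7)) (v : Bool) (s₀ s₁ s₂ s₃ s₄ : List Bool) :
    TM2.Cfg (fun _ : Fin 5 => Bool) (Fin (C + 1) × Fin 7) Bool :=
  ⟨l, v, ![s₀, s₁, s₂, s₃, s₄]⟩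

theorem update_stacks (s₀ s₁ s₂ s₃ s₄ t : List Bool) :
    Function.update ![s₀, s₁, s₂, s₃, s₄] 0 t = ![t, s₁, s₂, s₃, s₄] ∧
    Function.update ![s₀, s₁, s₂, s₃, s₄] 1 t = ![s₀, t, s₂, s₃, s₄] ∧
    Function.update ![s₀, s₁, s₂, s₃, s₄] 2 t = ![s₀, s₁, t, s₃, s₄] ∧
    Function.update ![s₀, s₁, s₂, s₃, s₄] 3 t = ![s₀, s₁, s₂, t, s₄] ∧
    Function.update ![s₀, s₁, s₂, s₃, s₄] 4 t = ![s₀, s₁, s₂, s₃, t] := by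
  refine ⟨?_, ?_, ?_, ?_, ?_⟩ <;> funext k <;> fin_cases k <;> rfl

variable {C : ℕ}

theorem runsIn_copy (i : Fin (C + 1)) (v : Bool) (s s₁ s₂ s₃ s₄ : List Bool) :
    RunsIn (powProgram C) (powCfg (some (i, 2)) v s s₁ s₂ s₃ s₄)
      (powCfg (some (i, 3)) false [] (List.replicate s.length true ++ s₁) s₂
        (List.replicate s.length true ++ s₃) s₄) (s.length + 1) := by
  induction s generalizing v s₁ s₃ with
  | nil => exact .of_step (by
      simp [powCfg, powProgram, popBranch, update_stacks])
  | cons b s ih =>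
    have h := ih true (true :: s₁) (true :: s₃)
    have h' : RunsIn (powProgram C) (powCfg (some (i, 2)) v (b :: s) s₁ s₂ s₃ s₄)
        (powCfg (some (i, 2)) true s (true :: s₁) s₂ (true :: s₃) s₄) 1 := .of_step (by
      simp [powCfg, powProgram, popBranch, update_stacks])
    have := h'.trans h
    simpa [List.replicate_succ', add_comm] using this

theorem runsIn_restore (i : Fin (C + 1)) (v : Bool) (s₀ s s₂ s₃ s₄ : List Bool) :
    RunsIn (powProgram C) (powCfg (some (i, 3)) v s₀ s s₂ s₃ s₄)
      (powCfg (some (i, 1)) false (List.replicate s.length true ++ s₀) [] s₂ s₃ s₄)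
      (s.length + 1) := by
  induction s generalizing v s₀ with
  | nil => exact .of_step (by
      simp [powCfg, powProgram, popBranch, update_stacks])
  | cons b s ih =>
    have h' : RunsIn (powProgram C) (powCfg (some (i, 3)) v s₀ (b :: s) s₂ s₃ s₄)
        (powCfg (some (i, 3)) true (true :: s₀) s s₂ s₃ s₄) 1 := .of_step (by
      simp [powCfg, powProgram, popBranch, update_stacks])
    have := h'.trans (ih true (true :: s₀))
    simpa [List.replicate_succ', add_comm] using this

theorem runsIn_move (i : Fin (C + 1)) (v : Bool) (s₀ s₁ s₂ s s₄ : List Bool) :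
    RunsIn (powProgram C) (powCfg (some (i, 4)) v s₀ s₁ s₂ s s₄)
      (powCfg (some (i - 1, 1)) false s₀ s₁ (List.replicate s.length true ++ s₂) [] s₄)
      (s.length + 1) := by
  induction s generalizing v s₂ with
  | nil => exact .of_step (by
      simp [powCfg, powProgram, popBranch, update_stacks])
  | cons b s ih =>
    have h' : RunsIn (powProgram C) (powCfg (some (i, 4)) v s₀ s₁ s₂ (b :: s) s₄)
        (powCfg (some (i, 4)) true s₀ s₁ (true :: s₂) s s₄) 1 := .of_step (by
      simp [powCfg, powProgram, popBranch, update_stacks])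
    have := h'.trans (ih true (true :: s₂))
    simpa [List.replicate_succ', add_comm] using this

theorem runsIn_clear (i : Fin (C + 1)) (v : Bool) (s s₁ s₂ s₃ s₄ : List Bool) :
    RunsIn (powProgram C) (powCfg (some (i, 5)) v s s₁ s₂ s₃ s₄)
      (powCfg (some (i, 6)) false [] s₁ s₂ s₃ ([true, true, false, false] ++ s₄))
      (s.length + 1) := by
  induction s generalizing v with
  | nil => exact .of_step (by
      simp [powCfg, powProgram, popBranch, pushAll, update_stacks])
  | cons b s ih =>
    have h' : RunsIn (powProgram C) (powCfg (some (i, 5)) v (b :: s) s₁ s₂ s₃ s₄)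
        (powCfg (some (i, 5)) true s s₁ s₂ s₃ s₄) 1 := .of_step (by
      simp [powCfg, powProgram, popBranch, update_stacks])
    simpa [add_comm] using h'.trans (ih true)

theorem runsIn_write (i : Fin (C + 1)) (v : Bool) (s₀ s₁ s s₃ s₄ : List Bool) :
    RunsIn (powProgram C) (powCfg (some (i, 6)) v s₀ s₁ s s₃ s₄)
      (powCfg none false s₀ s₁ [] s₃ ([true, false, true, true, false, false, true, false] ++
        (List.replicate s.length false).flatMap digit ++ s₄)) (s.length + 1) := by
  induction s generalizing v s₄ with
  | nil => exact .of_step (by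
      simp [powCfg, powProgram, popBranch, pushAll, update_stacks])
  | cons b s ih =>
    have h' : RunsIn (powProgram C) (powCfg (some (i, 6)) v s₀ s₁ (b :: s) s₃ s₄)
        (powCfg (some (i, 6)) true s₀ s₁ s s₃ (true :: false :: s₄)) 1 := .of_step (by
      simp [powCfg, powProgram, popBranch, pushAll, update_stacks])
    have := h'.trans (ih true _)
    simpa [List.replicate_succ', add_comm, digit] using this

/-- One multiplication of the number on stack `2` by the input length. -/
theorem runsIn_mul_loop (i : Fin (C + 1)) (hi : i ≠ 0) (v : Bool) (s₀ s s₃ s₄ : List Bool) :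
    ∃ (s₀' : List Bool), s₀'.length = s₀.length ∧
    RunsIn (powProgram C) (powCfg (some (i, 1)) v s₀ [] s s₃ s₄)
      (powCfg (some (i, 4)) false s₀' [] []
        (List.replicate (s.length * s₀.length) true ++ s₃) s₄)
      (s.length * (2 * s₀.length + 3) + 1) := by
  induction s generalizing v s₀ s₃ with
  | nil =>
    have h : RunsIn (powProgram C) (powCfg (some (i, 1)) v s₀ [] [] s₃ s₄)
        (powCfg (some (i, 4)) false s₀ [] [] s₃ s₄) 1 := .of_step (by
      simp [powCfg, powProgram, popBranch, update_stacks, hi])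
    exact ⟨s₀, rfl, h.congr (by simp) (by simp)⟩
  | cons b s ih =>
    have h₁ : RunsIn (powProgram C) (powCfg (some (i, 1)) v s₀ [] (b :: s) s₃ s₄)
        (powCfg (some (i, 2)) true s₀ [] s s₃ s₄) 1 := .of_step (by
      simp [powCfg, powProgram, popBranch, update_stacks, hi])
    have h₂ := (h₁.trans (runsIn_copy i true s₀ [] s s₃ s₄)).trans (runsIn_restore ..)
    obtain ⟨s₀', hs, h₃⟩ := ih false _ _
    refine ⟨s₀', ?_, ?_⟩
    rotate_left
    · refine (h₂.trans h₃).congr ?_ ?_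
      · simp [← List.append_assoc, List.replicate_append_replicate, Nat.succ_mul]
      · simp only [List.append_nil, List.length_replicate, List.length_cons]
        ring
    · simpa using hs

theorem runsIn_mul (i : Fin (C + 1)) (hi : i ≠ 0) (v : Bool) (s₀ s s₄ : List Bool) :
    ∃ (s₀' : List Bool), s₀'.length = s₀.length ∧
    RunsIn (powProgram C) (powCfg (some (i, 1)) v s₀ [] s [] s₄)
      (powCfg (some (i - 1, 1)) false s₀' []
        (List.replicate (s.length * s₀.length) true) [] s₄)
      (s.length * (3 * s₀.length + 3) + 2) := by
  obtain ⟨s₀', hs, h⟩ := runsIn_mul_loop i hi v s₀ s [] s₄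
  refine ⟨s₀', hs, ?_⟩
  refine (h.trans (runsIn_move ..)).congr (by simp) ?_
  simp only [List.append_nil, List.length_replicate]
  ring

theorem runsIn_pow (n : ℕ) (hn : n < C + 1) (v : Bool) (s₀ : List Bool) (a : ℕ)
    (s₄ : List Bool) :
    ∃ (s₀' : List Bool) (v' : Bool), s₀'.length = s₀.length ∧
    RunsIn (powProgram C) (powCfg (some (⟨n, hn⟩, 1)) v s₀ [] (List.replicate a true) [] s₄)
      (powCfg (some (0, 5)) v' s₀' [] (List.replicate (a * s₀.length ^ n) true) [] s₄)
      ((∑ i ∈ Finset.range n, (a * s₀.length ^ i * (3 * s₀.length + 3) + 2)) + 1) := by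
  induction n generalizing v s₀ a with
  | zero =>
    exact ⟨s₀, v, rfl, .of_step (by simp [powCfg, powProgram])⟩
  | succ n ih =>
    obtain ⟨s₀', hs, h⟩ := runsIn_mul (⟨n + 1, hn⟩ : Fin (C + 1)) (by simp [Fin.ext_iff]) v s₀
      (List.replicate a true) s₄
    rw [List.length_replicate] at h
    have hpred : (⟨n + 1, hn⟩ : Fin (C + 1)) - 1 = ⟨n, by omega⟩ := by
      rw [sub_eq_iff_eq_add]
      ext
      have : n + 1 < C + 1 := hn
      rw [Fin.val_add]
      rcases C with _ | C
      · omega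
      · simp [Nat.mod_eq_of_lt this]
    rw [hpred] at h
    obtain ⟨s₀'', v', hs', h'⟩ := ih (by omega) false s₀' (a * s₀.length)
    refine ⟨s₀'', v', hs'.trans hs, (h.trans h').congr ?_ ?_⟩
    · rw [hs, pow_succ']
      simp only [mul_assoc]
    · rw [hs, Finset.sum_range_succ', pow_zero, mul_one]
      simp only [pow_succ']
      simp only [← mul_assoc]
      ring

/-- The running time of `powMachine`. -/
noncomputable def powTime (C : ℕ) : Polynomial ℕ :=
  (∑ i ∈ Finset.range C, (Polynomial.X ^ i * (3 * Polynomial.X + 3) + 2)) + Polynomial.X +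
    Polynomial.X ^ C + 4

theorem runsIn_powMachine (C : ℕ) (s : List Bool) :
    RunsIn (powProgram C) (powCfg (some (Fin.last C, 0)) false s [] [] [] [])
      (powCfg none false [] [] [] [] ([true, false, true, true, false, false, true, false] ++
        (List.replicate (s.length ^ C) false).flatMap digit ++ [true, true, false, false]))
      ((powTime C).eval s.length) := by
  have h₁ : RunsIn (powProgram C) (powCfg (some (Fin.last C, 0)) false s [] [] [] [])
      (powCfg (some (Fin.last C, 1)) false s [] [true] [] []) 1 := .of_step (by
    simp [powCfg, powProgram, update_stacks])
  obtain ⟨s', v', hs, h₂⟩ := runsIn_pow C (Nat.lt_succ_self C) false s 1 []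
  refine (((h₁.trans h₂).trans (runsIn_clear ..)).trans (runsIn_write ..)).congr ?_ ?_
  · simp
  · simp [powTime, Polynomial.eval_finsetSum, hs]
    ring

theorem encodePosNum_iterate_bit0 (T : ℕ) :
    Computability.encodePosNum (PosNum.bit0^[T] PosNum.one) = List.replicate T false ++ [true] := by
  induction T with
  | zero => rfl
  | succ T ih =>
    rw [Function.iterate_succ_apply', Computability.encodePosNum, ih, List.replicate_succ]
    rfl

theorem encodeNat_two_pow (T : ℕ) :
    Computability.encodeNat (2 ^ T) = List.replicate T false ++ [true] := by
  have h : ∀ T : ℕ, ((PosNum.bit0^[T] PosNum.one : PosNum) : ℕ) = 2 ^ T := by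
    intro T
    induction T with
    | zero => rfl
    | succ T ih => rw [Function.iterate_succ_apply', PosNum.cast_bit0, ih]; ring
  have h' : ((2 ^ T : ℕ) : Num) = Num.pos (PosNum.bit0^[T] PosNum.one) := by
    rw [← h T]
    exact Num.of_to_nat (Num.pos _)
  rw [Computability.encodeNat, h', Computability.encodeNum, encodePosNum_iterate_bit0]

theorem encodeRat_inv_two_pow (T : ℕ) :
    encodeRat (1 / 2 ^ T) = [true, false, true, true, false, false, true, false] ++
      (List.replicate T false).flatMap digit ++ [true, true, false, false] := by
  have hnum : ((1 / 2 ^ T : ℚ)).num = 1 := by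
    simp
  have hden : ((1 / 2 ^ T : ℚ)).den = 2 ^ T := by
    simp
  have h1 : Computability.encodeNat 1 = [true] := encodeNat_two_pow 0
  have h2 : ¬ ((2 : ℤ) ^ T < 0) := not_lt.mpr (by positivity)
  rw [encodeRat, hnum, hden, encodeInt, encodeInt, Int.natAbs_natCast, encodeNat_two_pow]
  simp [h1, h2, digit, comma]

/-- The function `F ↦ 2 ^ (-‖F‖ ^ C)` is computable in polynomial time. -/
noncomputable def invTwoPowComputable (C : ℕ) :
    TM2ComputableInPolyTime encodeFun encodeRat (fun F => 1 / 2 ^ (F.size ^ C)) where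
  tm := powMachine C
  inputAlphabet := Equiv.refl Bool
  outputAlphabet := Equiv.refl Bool
  time := powTime C
  outputsFun F :=
    { steps := (powTime C).eval (encodeFun F).length
      evals_in_steps := by
        have h := runsIn_powMachine C (encodeFun F)
        rw [← encodeRat_inv_two_pow] at h
        have h₁ : initList (powMachine C) (List.map (Equiv.refl Bool).invFun (encodeFun F)) =
            powCfg (some (Fin.last C, 0)) false (encodeFun F) [] [] [] [] := by
          have h : ∀ k : Fin 5, (initList (powMachine C)
              (List.map (Equiv.refl Bool).invFun (encodeFun F))).stk k =
              ![encodeFun F, [], [], [], []] k := by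
            intro k
            fin_cases k
            · exact List.map_id _
            all_goals rfl
          exact congrArg (TM2.Cfg.mk _ _) (funext h)
        have h₂ : haltList (powMachine C) (List.map (Equiv.refl Bool).invFun
              (encodeRat (1 / 2 ^ (F.size ^ C)))) =
            powCfg none false [] [] [] [] (encodeRat (1 / 2 ^ (F.size ^ C))) := by
          have h : ∀ k : Fin 5, (haltList (powMachine C) (List.map (Equiv.refl Bool).invFun
              (encodeRat (1 / 2 ^ (F.size ^ C))))).stk k =
              ![[], [], [], [], encodeRat (1 / 2 ^ (F.size ^ C))] k := by
            intro k
            fin_cases k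
            iterate 4 rfl
            exact List.map_id _
          exact congrArg (TM2.Cfg.mk _ _) (funext h)
        rw [Option.map_some]
        exact (congrArg _ (congrArg some h₁)).trans (Eq.trans h (congrArg some h₂.symm))
      steps_le_m := le_rfl }

end Machine

/-! ### A Liouville inequality -/

section Liouville

theorem one_le_norm_mul_pow_finrank {K : Type*} [Field K] [NumberField K] {x : K}
    (hx : IsIntegral ℤ x) (hx0 : x ≠ 0) {M : ℝ} (hM : 1 ≤ M) (hb : ∀ σ : K →+* ℂ, ‖σ x‖ ≤ M)
    (τ : K →+* ℂ) : 1 ≤ ‖τ x‖ * M ^ Module.finrank ℚ K := by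
  classical
  have h1 : IsIntegral ℤ (Algebra.norm ℚ x) := Algebra.isIntegral_norm ℚ hx
  obtain ⟨m, hm⟩ := IsIntegrallyClosed.isIntegral_iff.mp h1
  have hm0 : m ≠ 0 := by
    rintro rfl
    rw [map_zero] at hm
    exact hx0 (Algebra.norm_eq_zero_iff.mp hm.symm)
  have h2 : (m : ℂ) = ∏ σ : K →ₐ[ℚ] ℂ, σ x := by
    rw [← Algebra.norm_eq_prod_embeddings ℚ ℂ x, ← hm]
    simp
  have h3 : (1 : ℝ) ≤ ∏ σ : K →ₐ[ℚ] ℂ, ‖σ x‖ := by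
    rw [← norm_prod, ← h2, Complex.norm_intCast]
    exact_mod_cast Int.one_le_abs hm0
  have h4 : ∏ σ : K →ₐ[ℚ] ℂ, ‖σ x‖ ≤ ‖τ x‖ * M ^ Module.finrank ℚ K := by
    rw [← Finset.mul_prod_erase Finset.univ _ (Finset.mem_univ τ.toRatAlgHom)]
    refine mul_le_mul_of_nonneg_left ?_ (norm_nonneg _)
    calc _ ≤ ∏ _σ ∈ Finset.univ.erase τ.toRatAlgHom, M :=
          Finset.prod_le_prod (fun _ _ => norm_nonneg _) fun σ _ => hb σ.toRingHom
      _ = M ^ (Finset.univ.erase τ.toRatAlgHom).card := by simp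
      _ ≤ M ^ Module.finrank ℚ K := by
          refine pow_le_pow_right₀ hM ?_
          rw [← AlgHom.card ℚ K ℂ]
          exact Finset.card_le_univ _
  exact h3.trans h4

theorem norm_leading_mul_root_le {n : ℕ} (hn : 1 ≤ n) {a : ℕ → ℂ} {z : ℂ} {H : ℝ}
    (ha : ∀ j ≤ n, ‖a j‖ ≤ H) (hz : ∑ j ∈ Finset.range (n + 1), a j * z ^ j = 0) :
    ‖a n * z‖ ≤ n * H := by
  have hH : 0 ≤ H := (norm_nonneg _).trans (ha 0 (Nat.zero_le _))
  have hn' : (1 : ℝ) ≤ n := by exact_mod_cast hn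
  rcases le_or_gt ‖z‖ 1 with h | h
  · calc ‖a n * z‖ = ‖a n‖ * ‖z‖ := norm_mul _ _
      _ ≤ H * 1 := mul_le_mul (ha n le_rfl) h (norm_nonneg _) hH
      _ ≤ n * H := by nlinarith
  · obtain ⟨m, rfl⟩ : ∃ m, n = m + 1 := ⟨n - 1, by omega⟩
    rw [Finset.sum_range_succ] at hz
    have h1 : ‖a (m + 1) * z‖ * ‖z‖ ^ m ≤ ((m + 1 : ℕ) * H) * ‖z‖ ^ m := by
      calc ‖a (m + 1) * z‖ * ‖z‖ ^ m = ‖a (m + 1) * z ^ (m + 1)‖ := by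
            rw [norm_mul, norm_mul, norm_pow]; ring
        _ = ‖∑ j ∈ Finset.range (m + 1), a j * z ^ j‖ := by
            rw [← norm_neg]
            congr 1
            linear_combination -hz
        _ ≤ ∑ j ∈ Finset.range (m + 1), H * ‖z‖ ^ m := by
            refine norm_sum_le_of_le _ fun j hj => ?_
            have hj' := Finset.mem_range.mp hj
            rw [norm_mul, norm_pow]
            exact mul_le_mul (ha j hj'.le) (pow_le_pow_right₀ h.le (by omega)) (by positivity) hH
        _ = ((m + 1 : ℕ) * H) * ‖z‖ ^ m := by simp [mul_assoc]
    exact le_of_mul_le_mul_right h1 (by positivity)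

theorem isIntegral_leading_mul_root {K : Type*} [Field K] {n : ℕ} {a : ℕ → K} {z : K}
    (ha : ∀ j, IsIntegral ℤ (a j)) (h0 : a n ≠ 0)
    (hz : ∑ j ∈ Finset.range (n + 1), a j * z ^ j = 0) : IsIntegral ℤ (a n * z) := by
  let b : ℕ → integralClosure ℤ K := fun j => ⟨a j, ha j⟩
  let p : Polynomial (integralClosure ℤ K) :=
    ∑ j ∈ Finset.range (n + 1), Polynomial.monomial j (b j)
  have hcoeff : p.coeff n = b n := by
    simp [p, Polynomial.coeff_monomial]
  have hb : b n ≠ 0 := fun h => h0 (congrArg Subtype.val h)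
  have hdeg : p.natDegree = n := by
    refine le_antisymm (Polynomial.natDegree_sum_le_of_forall_le _ _ fun j hj => ?_)
      (Polynomial.le_natDegree_of_ne_zero (hcoeff ▸ hb))
    exact (Polynomial.natDegree_monomial_le _).trans (Nat.lt_succ_iff.mp (Finset.mem_range.mp hj))
  have hroot : Polynomial.aeval z p = 0 := by
    rw [map_sum, ← hz]
    refine Finset.sum_congr rfl fun j _ => ?_
    rw [Polynomial.aeval_monomial]
    rfl
  have h := isIntegral_leadingCoeff_smul p z hroot
  rw [Polynomial.leadingCoeff, hdeg, hcoeff] at h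
  exact isIntegral_trans (R := ℤ) (A := integralClosure ℤ K) _ h

variable {K : Type*} [Field K] [NumberField K] {n : ℕ} {a : ℕ → K} {z : K} {H : ℝ}

theorem norm_embedding_leading_mul_root_le (hn : 1 ≤ n)
    (hH : ∀ j ≤ n, ∀ σ : K →+* ℂ, ‖σ (a j)‖ ≤ H)
    (hz : ∑ j ∈ Finset.range (n + 1), a j * z ^ j = 0) (σ : K →+* ℂ) :
    ‖σ (a n) * σ z‖ ≤ n * H :=
  norm_leading_mul_root_le hn (a := fun j => σ (a j)) (fun j hj => hH j hj σ) (by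
    rw [← map_zero σ, ← hz]; simp)

/-- Lower bound for the value at a root `z` of `∑ a_j X^j` of a polynomial with coefficients
`w_j a_j`, where the `w_j` are integers. -/
theorem one_le_norm_weighted_sum (hn : 1 ≤ n) (ha : ∀ j, IsIntegral ℤ (a j)) (h0 : a n ≠ 0)
    (hH1 : 1 ≤ H) (hH : ∀ j ≤ n, ∀ σ : K →+* ℂ, ‖σ (a j)‖ ≤ H)
    (hz : ∑ j ∈ Finset.range (n + 1), a j * z ^ j = 0) {w : ℕ → ℤ} {W : ℝ} (hW1 : 1 ≤ W)
    (hW : ∀ j ≤ n, |(w j : ℝ)| ≤ W)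
    (hne : ∑ j ∈ Finset.range (n + 1), (w j : K) * a j * z ^ j ≠ 0) (τ : K →+* ℂ) :
    1 ≤ ‖τ (∑ j ∈ Finset.range (n + 1), (w j : K) * a j * z ^ j)‖ *
      (H ^ n * ((n + 1) * (W * H * (n * H) ^ n)) ^ Module.finrank ℚ K) := by
  have hn' : (1 : ℝ) ≤ n := by exact_mod_cast hn
  have hnH : H ≤ n * H := by nlinarith
  have hint := isIntegral_leading_mul_root ha h0 hz
  have hD : a n ^ n * ∑ j ∈ Finset.range (n + 1), (w j : K) * a j * z ^ j =
      ∑ j ∈ Finset.range (n + 1), (w j : K) * a j * ((a n * z) ^ j * a n ^ (n - j)) := by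
    rw [Finset.mul_sum]
    refine Finset.sum_congr rfl fun j hj => ?_
    have e : a n ^ n = a n ^ j * a n ^ (n - j) := by
      have := Finset.mem_range.mp hj
      rw [← pow_add]; congr 1; omega
    rw [mul_pow, e]
    ring
  set S := ∑ j ∈ Finset.range (n + 1), (w j : K) * a j * z ^ j
  have hSint : IsIntegral ℤ (a n ^ n * S) := by
    rw [hD]
    refine IsIntegral.sum _ fun j _ => ?_
    exact ((isIntegral_algebraMap (x := w j)).mul (ha j)).mul ((hint.pow j).mul ((ha n).pow _))
  have hbound : ∀ σ : K →+* ℂ, ‖σ (a n ^ n * S)‖ ≤ (n + 1) * (W * H * (n * H) ^ n) := by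
    intro σ
    rw [hD, map_sum]
    have : ∀ j ∈ Finset.range (n + 1),
        ‖σ ((w j : K) * a j * ((a n * z) ^ j * a n ^ (n - j)))‖ ≤ W * H * (n * H) ^ n := by
      intro j hj
      have hjn : j ≤ n := Nat.lt_succ_iff.mp (Finset.mem_range.mp hj)
      have e : (n * H) ^ n = (n * H) ^ j * (n * H) ^ (n - j) := by
        rw [← pow_add]; congr 1; omega
      rw [map_mul, map_mul, map_mul, map_pow, map_pow, map_intCast, norm_mul, norm_mul, norm_mul,
        norm_pow, norm_pow, Complex.norm_intCast, e, map_mul]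
      have h1 := norm_embedding_leading_mul_root_le hn hH hz σ
      have h2 := (hH n le_rfl σ).trans hnH
      have h3 := hH j hjn σ
      have h4 := hW j hjn
      gcongr
    refine (norm_sum_le_of_le _ this).trans ?_
    simp
  have hM : (1 : ℝ) ≤ (n + 1) * (W * H * (n * H) ^ n) := by
    have h1 : (1 : ℝ) ≤ (n * H) ^ n := one_le_pow₀ (hH1.trans hnH)
    have h2 : (1 : ℝ) ≤ W * H := one_le_mul_of_one_le_of_one_le hW1 hH1
    exact one_le_mul_of_one_le_of_one_le (by linarith) (one_le_mul_of_one_le_of_one_le h2 h1)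
  have h := one_le_norm_mul_pow_finrank hSint (mul_ne_zero (pow_ne_zero _ h0) hne) hM hbound τ
  rw [map_mul, norm_mul, map_pow, norm_pow] at h
  refine h.trans ?_
  have := pow_le_pow_left₀ (norm_nonneg _) (hH n le_rfl τ) n
  calc _ = ‖τ (a n)‖ ^ n * (‖τ S‖ * ((n + 1) * (W * H * (n * H) ^ n)) ^ Module.finrank ℚ K) := by
        ring
    _ ≤ H ^ n * (‖τ S‖ * ((n + 1) * (W * H * (n * H) ^ n)) ^ Module.finrank ℚ K) := by gcongr
    _ = _ := by ring

/-- Lower bound for the distance from `-1` of a root `z` of `∑ a_j X^j`. -/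
theorem one_le_norm_root_add_one (hn : 1 ≤ n) (ha : ∀ j, IsIntegral ℤ (a j)) (h0 : a n ≠ 0)
    (hH1 : 1 ≤ H) (hH : ∀ j ≤ n, ∀ σ : K →+* ℂ, ‖σ (a j)‖ ≤ H)
    (hz : ∑ j ∈ Finset.range (n + 1), a j * z ^ j = 0) (hne : z + 1 ≠ 0) (τ : K →+* ℂ) :
    1 ≤ ‖τ (z + 1)‖ * (H * ((n + 1) * H) ^ Module.finrank ℚ K) := by
  have hint := isIntegral_leading_mul_root ha h0 hz
  have h := one_le_norm_mul_pow_finrank (x := a n * (z + 1)) (M := (n + 1) * H)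
    (by rw [mul_add, mul_one]; exact hint.add (ha n)) (mul_ne_zero h0 hne)
    (by
      have : (0 : ℝ) ≤ n := Nat.cast_nonneg n
      nlinarith)
    (fun σ => by
      rw [mul_add, mul_one, map_add, map_mul, add_mul, one_mul]
      exact (norm_add_le _ _).trans
        (add_le_add (norm_embedding_leading_mul_root_le hn hH hz σ) (hH n le_rfl σ))) τ
  rw [map_mul, norm_mul] at h
  refine h.trans ?_
  have := hH n le_rfl τ
  calc _ = ‖τ (a n)‖ * (‖τ (z + 1)‖ * ((n + 1) * H) ^ Module.finrank ℚ K) := by ring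
    _ ≤ H * (‖τ (z + 1)‖ * ((n + 1) * H) ^ Module.finrank ℚ K) := by gcongr
    _ = _ := by ring

end Liouville

/-! ### Taylor estimates -/

section Taylor

theorem hasDerivAt_sub_pow_succ (φ y : ℝ) (d : ℕ) :
    HasDerivAt (fun y : ℝ => (y - φ) ^ (d + 1)) ((d + 1 : ℕ) * (y - φ) ^ d) y := by
  simpa using! ((hasDerivAt_id y).sub_const φ).fun_pow (d + 1)

theorem abs_sub_taylor_term_le {f : ℕ → ℝ → ℝ} (hf : ∀ n x, HasDerivAt (f n) (f (n + 1) x) x)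
    {φ M : ℝ} {d : ℕ} (hM : ∀ x, |f (d + 1) x| ≤ M) (h0 : ∀ j < d, f j φ = 0) (x : ℝ) :
    |f 0 x - f d φ / d.factorial * (x - φ) ^ d| ≤ M * |x - φ| ^ (d + 1) := by
  induction d generalizing f x with
  | zero =>
    simpa using convex_univ.norm_image_sub_le_of_norm_hasDerivWithin_le
      (fun y _ => (hf 0 y).hasDerivWithinAt) (fun y _ => hM y) (Set.mem_univ φ) (Set.mem_univ x)
  | succ d ih =>
    have hM0 : 0 ≤ M := (abs_nonneg _).trans (hM φ)
    have h' := ih (f := fun n => f (n + 1)) (fun n => hf (n + 1)) hM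
      (fun j hj => h0 (j + 1) (by omega))
    have hder : ∀ y, HasDerivAt
        (fun y => f 0 y - f (d + 1) φ / (d + 1).factorial * (y - φ) ^ (d + 1))
        (f 1 y - f (d + 1) φ / d.factorial * (y - φ) ^ d) y := by
      intro y
      convert! (hf 0 y).sub ((hasDerivAt_sub_pow_succ φ y d).const_mul
        (f (d + 1) φ / (d + 1).factorial)) using 2
      rw [Nat.factorial_succ]
      have : (d.factorial : ℝ) ≠ 0 := by positivity
      have : ((d : ℝ) + 1) ≠ 0 := by positivity
      push_cast
      field_simp
    have hbd : ∀ y ∈ Set.uIcc φ x, ‖f 1 y - f (d + 1) φ / d.factorial * (y - φ) ^ d‖ ≤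
        M * |x - φ| ^ (d + 1) := by
      intro y hy
      refine (h' y).trans ?_
      have : |y - φ| ≤ |x - φ| := Set.abs_sub_left_of_mem_uIcc hy
      gcongr
    have := (convex_uIcc φ x).norm_image_sub_le_of_norm_hasDerivWithin_le
      (fun y _ => (hder y).hasDerivWithinAt) hbd Set.left_mem_uIcc Set.right_mem_uIcc
    simp only [sub_self, ne_eq, Nat.succ_ne_zero, not_false_eq_true, zero_pow, mul_zero,
      sub_zero, h0 0 (Nat.succ_pos d)] at this
    calc _ ≤ M * |x - φ| ^ (d + 1) * ‖x - φ‖ := this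
      _ = _ := by rw [Real.norm_eq_abs]; ring

theorem sign_eq_of_abs_sub_le {a b : ℝ} (h : |a - b| ≤ 1 / 2 * |b|) :
    SignType.sign a = SignType.sign b := by
  rcases lt_trichotomy b 0 with hb | rfl | hb
  · rw [abs_of_neg hb] at h
    rw [sign_neg hb, sign_neg (by linarith [le_abs_self (a - b)])]
  · have : a = 0 := by simpa using h
    rw [this]
  · rw [abs_of_pos hb] at h
    rw [sign_pos hb, sign_pos (by linarith [neg_abs_le (a - b)])]

theorem iteratedDeriv_eq_of_hasDerivAt {f : ℕ → ℝ → ℝ}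
    (hf : ∀ n x, HasDerivAt (f n) (f (n + 1) x) x) (n : ℕ) : iteratedDeriv n (f 0) = f n := by
  induction n with
  | zero => exact iteratedDeriv_zero
  | succ n ih => rw [iteratedDeriv_succ, ih]; exact funext fun x => (hf n x).deriv

theorem goodRadius_of_bounds {f : ℕ → ℝ → ℝ} (hf : ∀ n x, HasDerivAt (f n) (f (n + 1) x) x)
    {φ M ε : ℝ} {d : ℕ} (hd : 1 ≤ d) (hM : ∀ x, |f (d + 1) x| ≤ M) (h0 : ∀ j < d, f j φ = 0)
    (hne : f d φ ≠ 0) (hε : 2 * d.factorial * M * ε ≤ |f d φ|) : GoodRadius (f 0) φ ε := by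
  obtain ⟨e, rfl⟩ : ∃ e, d = e + 1 := ⟨d - 1, by omega⟩
  have hM0 : 0 ≤ M := (abs_nonneg _).trans (hM φ)
  have hord : firstOrder (f 0) φ = e + 1 := by
    unfold firstOrder
    simp only [iteratedDeriv_eq_of_hasDerivAt hf]
    refine le_antisymm (Nat.sInf_le hne) (le_csInf ⟨_, hne⟩ fun j hj => ?_)
    by_contra hlt
    exact hj (h0 j (not_le.mp hlt))
  have hT : firstTaylor (f 0) φ =
      fun x => f (e + 1) φ / (e + 1).factorial * (x - φ) ^ (e + 1) := by
    funext x
    rw [firstTaylor, hord, iteratedDeriv_eq_of_hasDerivAt hf]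
  have hT' : ∀ x, deriv (firstTaylor (f 0) φ) x = f (e + 1) φ / e.factorial * (x - φ) ^ e := by
    intro x
    rw [hT]
    rw [((hasDerivAt_sub_pow_succ φ x e).const_mul _).deriv, Nat.factorial_succ]
    have : (e.factorial : ℝ) ≠ 0 := by positivity
    have : ((e : ℝ) + 1) ≠ 0 := by positivity
    push_cast
    field_simp
  have key : ∀ x ∈ Set.Ioo (φ - ε) (φ + ε), ∀ n m : ℕ, n.factorial ≤ (e + 1).factorial →
      M * |x - φ| ^ (m + 1) ≤ 1 / 2 * |f (e + 1) φ / n.factorial * (x - φ) ^ m| := by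
    intro x hx n m hnm
    have hx' : |x - φ| ≤ ε := abs_le.mpr ⟨by linarith [hx.1], by linarith [hx.2]⟩
    have hn : (0 : ℝ) < n.factorial := by positivity
    have hnm' : (n.factorial : ℝ) ≤ (e + 1).factorial := by exact_mod_cast hnm
    rw [abs_mul, abs_div, abs_pow, abs_of_pos hn, pow_succ']
    have h1 : M * |x - φ| ≤ 1 / 2 * (|f (e + 1) φ| / n.factorial) := by
      rw [← mul_div_assoc, le_div_iff₀ hn]
      have h2 : M * |x - φ| * n.factorial ≤ M * ε * (e + 1).factorial := by
        have hε0 : 0 ≤ ε := (abs_nonneg _).trans hx'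
        gcongr
      linarith
    calc M * (|x - φ| * |x - φ| ^ m) = M * |x - φ| * |x - φ| ^ m := by ring
      _ ≤ 1 / 2 * (|f (e + 1) φ| / n.factorial) * |x - φ| ^ m := by gcongr
      _ = _ := by ring
  have hsign : ∀ x ∈ Set.Ioo (φ - ε) (φ + ε), SignType.sign (deriv (f 0) x) =
      SignType.sign (f (e + 1) φ / e.factorial * (x - φ) ^ e) := by
    intro x hx
    rw [(hf 0 x).deriv]
    refine sign_eq_of_abs_sub_le ?_
    exact (abs_sub_taylor_term_le (f := fun n => f (n + 1)) (fun n => hf (n + 1)) hM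
      (fun j hj => h0 (j + 1) (by omega)) x).trans
      (key x hx e e (Nat.factorial_le (Nat.le_succ e)))
  refine ⟨fun x hx y hy => ?_, fun x hx y hy => ?_, fun x hx => ?_, fun x hx => ?_⟩
  · rw [hsign x ⟨by linarith [hx.1, hx.2], hx.2⟩, hsign y ⟨by linarith [hy.1, hy.2], hy.2⟩,
      sign_mul, sign_mul, sign_pow, sign_pow, sign_pos (sub_pos.mpr hx.1),
      sign_pos (sub_pos.mpr hy.1)]
  · rw [hsign x ⟨hx.1, by linarith [hx.1, hx.2]⟩, hsign y ⟨hy.1, by linarith [hy.1, hy.2]⟩,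
      sign_mul, sign_mul, sign_pow, sign_pow, sign_neg (sub_neg.mpr hx.2),
      sign_neg (sub_neg.mpr hy.2)]
  · rw [hT]
    exact (abs_sub_taylor_term_le hf hM h0 x).trans (key x hx (e + 1) (e + 1) le_rfl)
  · rw [hT', hsign x hx]

end Taylor

/-! ### Trigonometric polynomials -/

section Trigonometric

open Complex

/-- The `n`-th derivative of `∑ a_j e^{i(j - K)x}`, the sum being over `0 ≤ j ≤ 2 K`. -/
noncomputable def trigSum (a : ℕ → ℂ) (K n : ℕ) (x : ℝ) : ℂ :=
  ∑ j ∈ Finset.range (2 * K + 1), a j * (I * ((j : ℂ) - K)) ^ n * exp (I * ((j : ℂ) - K) * x)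

theorem hasDerivAt_trigSum (a : ℕ → ℂ) (K n : ℕ) (x : ℝ) :
    HasDerivAt (trigSum a K n) (trigSum a K (n + 1) x) x := by
  unfold trigSum
  refine HasDerivAt.fun_sum fun j _ => ?_
  have h1 : HasDerivAt (fun y : ℝ => I * ((j : ℂ) - K) * (y : ℂ)) (I * ((j : ℂ) - K)) x := by
    simpa using (Complex.ofRealCLM.hasDerivAt (x := x)).const_mul (I * ((j : ℂ) - K))
  convert! (h1.cexp).const_mul (a j * (I * ((j : ℂ) - K)) ^ n) using 1
  ring

theorem norm_natCast_sub_le {K j : ℕ} (hj : j ≤ 2 * K) : ‖(j : ℂ) - K‖ ≤ K := by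
  have : ((j : ℂ) - K) = (((j : ℤ) - K : ℤ) : ℂ) := by push_cast; rfl
  rw [this, Complex.norm_intCast]
  have h : |((j : ℤ) - K)| ≤ K := abs_le.mpr ⟨by omega, by omega⟩
  exact_mod_cast h

theorem norm_trigSum_le {a : ℕ → ℂ} {K : ℕ} {H : ℝ} (ha : ∀ j ≤ 2 * K, ‖a j‖ ≤ H) (n : ℕ)
    (x : ℝ) : ‖trigSum a K n x‖ ≤ (2 * K + 1) * (H * K ^ n) := by
  have hH : 0 ≤ H := (norm_nonneg _).trans (ha 0 (Nat.zero_le _))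
  have : ∀ j ∈ Finset.range (2 * K + 1),
      ‖a j * (I * ((j : ℂ) - K)) ^ n * exp (I * ((j : ℂ) - K) * x)‖ ≤ H * K ^ n := by
    intro j hj
    have hj' : j ≤ 2 * K := Nat.lt_succ_iff.mp (Finset.mem_range.mp hj)
    have h1 : ‖exp (I * ((j : ℂ) - K) * x)‖ = 1 := by
      have : I * ((j : ℂ) - K) * x = (((j : ℝ) - K) * x : ℝ) * I := by push_cast; ring
      rw [this, norm_exp_ofReal_mul_I]
    rw [norm_mul, norm_mul, norm_pow, norm_mul, norm_I, one_mul, h1, mul_one]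
    exact mul_le_mul (ha j hj') (pow_le_pow_left₀ (norm_nonneg _) (norm_natCast_sub_le hj') n)
      (by positivity) hH
  refine (norm_sum_le_of_le _ this).trans ?_
  simp

/-- If a trigonometric polynomial is real valued, so are its derivatives. -/
theorem ofReal_re_trigSum {a : ℕ → ℂ} {K : ℕ} (h : ∀ x, ((trigSum a K 0 x).re : ℂ) = trigSum a K 0 x)
    (n : ℕ) (x : ℝ) : ((trigSum a K n x).re : ℂ) = trigSum a K n x := by
  induction n generalizing x with
  | zero => exact h x
  | succ n ih =>
    have h1 := hasDerivAt_trigSum a K n x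
    have h2 : HasDerivAt (fun y => (trigSum a K n y).re) (trigSum a K (n + 1) x).re x := by
      simpa using! (Complex.reCLM.hasFDerivAt.comp_hasDerivAt x h1)
    have h3 := h2.ofReal_comp
    simp only [ih] at h3
    exact h3.unique h1

theorem exists_trigSum_ne_zero {a : ℕ → ℂ} {K : ℕ} (h : a (2 * K) ≠ 0) (x : ℝ) :
    ∃ n ≤ 2 * K, trigSum a K n x ≠ 0 := by
  by_contra! hc
  have := Matrix.eq_zero_of_forall_pow_sum_mul_pow_eq_zero (n := 2 * K + 1)
    (f := fun j => I * (((j : ℕ) : ℂ) - K))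
    (v := fun j => a j * exp (I * (((j : ℕ) : ℂ) - K) * x)) (fun i j hij => by
      have := mul_left_cancel₀ I_ne_zero hij
      exact Fin.ext (by exact_mod_cast sub_left_injective this)) (fun i => by
      rw [← hc i (Nat.lt_succ_iff.mp i.2), trigSum, ← Fin.sum_univ_eq_sum_range
        (fun j => a j * (I * ((j : ℂ) - K)) ^ (i : ℕ) * exp (I * ((j : ℂ) - K) * x))]
      exact Finset.sum_congr rfl fun j _ => by ring)
  have := congrFun this (Fin.last _)
  simp [h, exp_ne_zero] at this

/-- The value of a trigonometric polynomial in terms of an algebraic polynomial at `e^{ix}`. -/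
theorem trigSum_eq (a : ℕ → ℂ) (K n : ℕ) (x : ℝ) :
    exp (x * I) ^ K * trigSum a K n x =
      I ^ n * ∑ j ∈ Finset.range (2 * K + 1), (((j : ℤ) - K) ^ n : ℤ) * a j * exp (x * I) ^ j := by
  unfold trigSum
  rw [Finset.mul_sum, Finset.mul_sum]
  refine Finset.sum_congr rfl fun j _ => ?_
  have : exp (I * ((j : ℂ) - K) * x) * exp (x * I) ^ K = exp (x * I) ^ j := by
    rw [← exp_nat_mul, ← exp_nat_mul, ← exp_add]
    congr 1; ring
  rw [← this, mul_pow]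
  push_cast
  ring

theorem norm_trigSum_eq (a : ℕ → ℂ) (K n : ℕ) (x : ℝ) :
    ‖trigSum a K n x‖ =
      ‖∑ j ∈ Finset.range (2 * K + 1), (((j : ℤ) - K) ^ n : ℤ) * a j * exp (x * I) ^ j‖ := by
  have := congrArg norm (trigSum_eq a K n x)
  simpa [norm_exp_ofReal_mul_I] using this

end Trigonometric

/-! ### The coefficients of `z ^ K * f z` -/

section Coefficients

/-- The coefficient of `X ^ j` in `∑ m ≤ K, (b m * X ^ (K + m) + c m * X ^ (K - m))`. -/
def symCoeff {R : Type*} [Semiring R] (b c : ℕ → R) (K j : ℕ) : R :=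
  (if K ≤ j then b (j - K) else 0) + (if j ≤ K then c (K - j) else 0)

theorem map_symCoeff {R S : Type*} [Semiring R] [Semiring S] (f : R →+* S) (b c : ℕ → R)
    (K j : ℕ) : f (symCoeff b c K j) = symCoeff (fun m => f (b m)) (fun m => f (c m)) K j := by
  unfold symCoeff
  split_ifs <;> simp

theorem symCoeff_two_mul {R : Type*} [Semiring R] (b c : ℕ → R) {K : ℕ} (hK : 1 ≤ K) :
    symCoeff b c K (2 * K) = b K := by
  rw [symCoeff, if_pos (by omega), if_neg (by omega), add_zero]
  congr 1
  omega

theorem sum_symCoeff_mul {R : Type*} [CommSemiring R] (b c : ℕ → R) (K : ℕ) (u v : ℕ → R)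
    (w : ℕ → R) (hu : ∀ m ≤ K, w (K + m) = u m) (hv : ∀ m ≤ K, w (K - m) = v m) :
    ∑ j ∈ Finset.range (2 * K + 1), symCoeff b c K j * w j =
      ∑ m ∈ Finset.range (K + 1), (b m * u m + c m * v m) := by
  simp only [symCoeff, add_mul, Finset.sum_add_distrib]
  congr 1
  · rw [show 2 * K + 1 = K + (K + 1) by ring, Finset.sum_range_add]
    rw [Finset.sum_eq_zero, zero_add]
    · refine Finset.sum_congr rfl fun m hm => ?_
      rw [if_pos (by omega), hu m (Nat.lt_succ_iff.mp (Finset.mem_range.mp hm)),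
        Nat.add_sub_cancel_left]
    · intro j hj
      rw [if_neg (by have := Finset.mem_range.mp hj; omega), zero_mul]
  · rw [show 2 * K + 1 = (K + 1) + K by ring, Finset.sum_range_add, ← Finset.sum_flip]
    rw [Finset.sum_eq_zero (s := Finset.range K), add_zero]
    · refine Finset.sum_congr rfl fun m hm => ?_
      have := Finset.mem_range.mp hm
      rw [if_pos (by omega), hv m (by omega)]
      congr 2
      omega
    · intro j hj
      rw [if_neg (by omega), zero_mul]

open Complex in
theorem coe_circleFun_eq_trigSum {k K : ℕ} (hK : K ≤ k) (β : Fin (k + 1) → ℂ) (b : ℕ → ℂ)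
    (hb : ∀ m : Fin (k + 1), b m = β m) (h0 : ∀ m, K < m → b m = 0) (x : ℝ) :
    (circleFun β x : ℂ) = trigSum (symCoeff b (fun m => (starRingEnd ℂ) (b m)) K) K 0 x := by
  rw [circleFun, coe_dominant, trigSum]
  simp only [pow_zero, mul_one]
  rw [sum_symCoeff_mul b _ K (fun m => exp (x * I) ^ m)
    (fun m => (starRingEnd ℂ) (exp (x * I)) ^ m)]
  · simp only [← hb]
    rw [Fin.sum_univ_eq_sum_range (fun m => b m * exp (x * I) ^ m +
      (starRingEnd ℂ) (b m) * (starRingEnd ℂ) (exp (x * I)) ^ m)]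
    symm
    refine Finset.sum_subset (Finset.range_subset_range.mpr (by omega)) fun m _ hm => ?_
    rw [h0 m (by simpa using hm)]
    simp
  · intro m _
    rw [← exp_nat_mul]
    congr 1
    push_cast
    ring
  · intro m hm
    rw [← exp_conj, ← exp_nat_mul, map_mul, conj_I, conj_ofReal]
    congr 1
    rw [Nat.cast_sub hm]
    ring

end Coefficients

/-! ### Quantitative bounds -/

section Bounds

theorem norm_root_le_two_pow {p : Polynomial ℤ} (hp : p ≠ 0) {N : ℕ} (hdeg : p.natDegree ≤ N)
    (hcoeff : ∀ i ≤ p.natDegree, |p.coeff i| ≤ 2 ^ N) {z : ℂ} (hz : Polynomial.aeval z p = 0) :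
    ‖z‖ ≤ 2 ^ (2 * N) := by
  have hd : 1 ≤ p.natDegree := by
    by_contra h
    rw [Polynomial.eq_C_of_natDegree_eq_zero (by omega : p.natDegree = 0)] at hz hp
    simp at hz
    simp [hz] at hp
  rw [Polynomial.aeval_eq_sum_range] at hz
  have h := norm_leading_mul_root_le hd (a := fun j => (p.coeff j : ℂ)) (z := z) (H := 2 ^ N)
    (fun j hj => by
      rw [Complex.norm_intCast]
      exact_mod_cast hcoeff j hj) (by simpa using hz)
  have hl : (1 : ℝ) ≤ ‖(p.coeff p.natDegree : ℂ)‖ := by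
    rw [Complex.norm_intCast]
    exact_mod_cast Int.one_le_abs (Polynomial.leadingCoeff_ne_zero.mpr hp)
  have hN : (p.natDegree : ℝ) ≤ 2 ^ N := by
    exact_mod_cast hdeg.trans Nat.lt_two_pow_self.le
  rw [norm_mul] at h
  calc ‖z‖ ≤ ‖(p.coeff p.natDegree : ℂ)‖ * ‖z‖ := le_mul_of_one_le_left (norm_nonneg _) hl
    _ ≤ p.natDegree * 2 ^ N := h
    _ ≤ 2 ^ N * 2 ^ N := by gcongr
    _ = 2 ^ (2 * N) := by rw [two_mul, pow_add]

theorem norm_symCoeff_le {b c : ℕ → ℂ} {K : ℕ} {B : ℝ} (hb : ∀ m ≤ K, ‖b m‖ ≤ B)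
    (hc : ∀ m ≤ K, ‖c m‖ ≤ B) {j : ℕ} (hj : j ≤ 2 * K) : ‖symCoeff b c K j‖ ≤ 2 * B := by
  have hB : 0 ≤ B := (norm_nonneg _).trans (hb 0 (Nat.zero_le _))
  rw [two_mul]
  refine (norm_add_le _ _).trans (add_le_add ?_ ?_)
  · split_ifs
    · exact hb _ (by omega)
    · simpa using hB
  · split_ifs
    · exact hc _ (by omega)
    · simpa using hB

variable {L : Type*} [Field L] {N K R : ℕ} {b c : ℕ → L} {p : ℕ → Polynomial ℤ}
  {z : L}

theorem exists_common_denominator (hKN : K < N) (hp : ∀ m ≤ K, p m ≠ 0)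
    (hcoeff : ∀ m ≤ K, ∀ i ≤ (p m).natDegree, |(p m).coeff i| ≤ 2 ^ N) :
    ∃ A : ℤ, A ≠ 0 ∧ |A| ≤ 2 ^ (N ^ 2) ∧ ∀ m ≤ K, ∀ x : L, Polynomial.aeval x (p m) = 0 →
      IsIntegral ℤ ((A : L) * x) := by
  refine ⟨∏ m ∈ Finset.range (K + 1), (p m).leadingCoeff, ?_, ?_, ?_⟩
  · exact Finset.prod_ne_zero_iff.mpr fun m hm =>
      Polynomial.leadingCoeff_ne_zero.mpr (hp m (Nat.lt_succ_iff.mp (Finset.mem_range.mp hm)))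
  · rw [Finset.abs_prod]
    calc ∏ m ∈ Finset.range (K + 1), |(p m).leadingCoeff|
        ≤ ∏ m ∈ Finset.range (K + 1), (2 : ℤ) ^ N :=
          Finset.prod_le_prod (fun _ _ => abs_nonneg _) fun m hm =>
            hcoeff m (Nat.lt_succ_iff.mp (Finset.mem_range.mp hm)) _ le_rfl
      _ = 2 ^ (N * (K + 1)) := by rw [Finset.prod_const, Finset.card_range, ← pow_mul]
      _ ≤ 2 ^ (N ^ 2) := by
          refine pow_le_pow_right₀ (by norm_num) ?_
          rw [sq]
          gcongr
          omega
  · intro m hm x hx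
    obtain ⟨q, hq⟩ := Finset.dvd_prod_of_mem (fun m => (p m).leadingCoeff)
      (Finset.mem_range.mpr (Nat.lt_succ_iff.mpr hm))
    rw [hq]
    have h := isIntegral_leadingCoeff_smul (p m) x hx
    rw [zsmul_eq_mul] at h
    have : (((p m).leadingCoeff * q : ℤ) : L) * x = (q : L) * ((p m).leadingCoeff * x) := by
      push_cast; ring
    rw [this]
    exact (isIntegral_algebraMap (x := q)).mul h

theorem norm_embedding_symCoeff_le (hp : ∀ m ≤ K, p m ≠ 0) (hdeg : ∀ m ≤ K, (p m).natDegree ≤ N)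
    (hcoeff : ∀ m ≤ K, ∀ i ≤ (p m).natDegree, |(p m).coeff i| ≤ 2 ^ N)
    (hb : ∀ m ≤ K, Polynomial.aeval (b m) (p m) = 0)
    (hc : ∀ m ≤ K, Polynomial.aeval (c m) (p m) = 0) {j : ℕ} (hj : j ≤ 2 * K) (σ : L →+* ℂ) :
    ‖σ (symCoeff b c K j)‖ ≤ 2 ^ (2 * N + 1) := by
  have key : ∀ m ≤ K, ∀ x : L, Polynomial.aeval x (p m) = 0 → ‖σ x‖ ≤ 2 ^ (2 * N) := by
    intro m hm x hx
    refine norm_root_le_two_pow (hp m hm) (hdeg m hm) (hcoeff m hm) ?_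
    have := Polynomial.aeval_algHom_apply σ.toIntAlgHom x (p m)
    rw [hx, map_zero] at this
    exact this
  rw [map_symCoeff, pow_succ']
  exact norm_symCoeff_le (fun m hm => key m hm _ (hb m hm)) (fun m hm => key m hm _ (hc m hm)) hj

theorem root_lower_bounds [NumberField L] (hK : 1 ≤ K) (hKN : K < N) (hp : ∀ m ≤ K, p m ≠ 0)
    (hdeg : ∀ m ≤ K, (p m).natDegree ≤ N)
    (hcoeff : ∀ m ≤ K, ∀ i ≤ (p m).natDegree, |(p m).coeff i| ≤ 2 ^ N)
    (hb : ∀ m ≤ K, Polynomial.aeval (b m) (p m) = 0)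
    (hc : ∀ m ≤ K, Polynomial.aeval (c m) (p m) = 0) (hbK : b K ≠ 0)
    (hz : ∑ j ∈ Finset.range (2 * K + 1), symCoeff b c K j * z ^ j = 0)
    (hR : Module.finrank ℚ L ≤ R) (τ : L →+* ℂ) :
    (∀ d ≤ 2 * K,
      ∑ j ∈ Finset.range (2 * K + 1), ((((j : ℤ) - K) ^ d : ℤ) : L) * symCoeff b c K j * z ^ j ≠ 0 →
      1 ≤ ‖τ (∑ j ∈ Finset.range (2 * K + 1),
        ((((j : ℤ) - K) ^ d : ℤ) : L) * symCoeff b c K j * z ^ j)‖ *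
          2 ^ (9 * N ^ 3 + 20 * N ^ 3 * R)) ∧
    (z + 1 ≠ 0 → 1 ≤ ‖τ (z + 1)‖ * 2 ^ (9 * N ^ 3 + 20 * N ^ 3 * R)) := by
  obtain ⟨A, hA0, hA, hAint⟩ := exists_common_denominator (L := L) hKN hp hcoeff
  have hN : 1 ≤ N := by omega
  have hNN : N ≤ N ^ 2 := Nat.le_self_pow (by norm_num) N
  have hN3 : N ^ 2 ≤ N ^ 3 := Nat.pow_le_pow_right hN (by norm_num)
  have hA' : |(A : ℝ)| ≤ 2 ^ (N ^ 2) := by exact_mod_cast hA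
  have hAL : (A : L) ≠ 0 := by exact_mod_cast hA0
  set a : ℕ → L := fun j => if j ≤ 2 * K then (A : L) * symCoeff b c K j else 0 with ha_def
  have haj : ∀ j ≤ 2 * K, a j = A * symCoeff b c K j := fun j hj => if_pos hj
  have ha : ∀ j, IsIntegral ℤ (a j) := by
    intro j
    simp only [ha_def, symCoeff]
    split_ifs with h₁ h₂ h₃ h₃
    · rw [mul_add]
      exact (hAint _ (by omega) _ (hb _ (by omega))).add (hAint _ (by omega) _ (hc _ (by omega)))
    · rw [add_zero]
      exact hAint _ (by omega) _ (hb _ (by omega))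
    · rw [zero_add]
      exact hAint _ (by omega) _ (hc _ (by omega))
    · simpa using isIntegral_zero
    · exact isIntegral_zero
  have ha0 : a (2 * K) ≠ 0 := by
    rw [haj _ le_rfl, symCoeff_two_mul b c hK]
    exact mul_ne_zero hAL hbK
  have hH : ∀ j ≤ 2 * K, ∀ σ : L →+* ℂ, ‖σ (a j)‖ ≤ 2 ^ (4 * N ^ 2) := by
    intro j hj σ
    rw [haj j hj, map_mul, map_intCast, norm_mul, Complex.norm_intCast]
    calc |(A : ℝ)| * ‖σ (symCoeff b c K j)‖ ≤ 2 ^ (N ^ 2) * 2 ^ (2 * N + 1) := by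
          have := norm_embedding_symCoeff_le hp hdeg hcoeff hb hc hj σ
          gcongr
      _ = 2 ^ (N ^ 2 + (2 * N + 1)) := by rw [← pow_add]
      _ ≤ 2 ^ (4 * N ^ 2) := pow_le_pow_right₀ (by norm_num) (by omega)
  have hz' : ∑ j ∈ Finset.range (2 * K + 1), a j * z ^ j = 0 := by
    rw [← mul_zero (A : L), ← hz, Finset.mul_sum]
    refine Finset.sum_congr rfl fun j hj => ?_
    rw [haj j (Nat.lt_succ_iff.mp (Finset.mem_range.mp hj)), mul_assoc]
  have hH1 : (1 : ℝ) ≤ 2 ^ (4 * N ^ 2) := one_le_pow₀ (by norm_num)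
  have hnK : ((2 * K : ℕ) : ℝ) + 1 ≤ 2 ^ (2 * N) := by
    have : 2 * K + 1 ≤ 2 ^ (2 * N) := (by omega : 2 * K + 1 ≤ 2 * N).trans Nat.lt_two_pow_self.le
    exact_mod_cast this
  constructor
  · intro d hd hne
    have hW : ∀ j ≤ 2 * K, |((((j : ℤ) - K) ^ d : ℤ) : ℝ)| ≤ 2 ^ (2 * N ^ 2) := by
      intro j hj
      push_cast
      rw [abs_pow]
      have h1 : |(j : ℝ) - K| ≤ 2 ^ N := by
        have h2 : |((j : ℤ) - K)| ≤ K := abs_le.mpr ⟨by omega, by omega⟩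
        have h3 : (K : ℤ) ≤ 2 ^ N := by exact_mod_cast hKN.le.trans Nat.lt_two_pow_self.le
        exact_mod_cast h2.trans h3
      calc |(j : ℝ) - K| ^ d ≤ (2 ^ N) ^ d := pow_le_pow_left₀ (abs_nonneg _) h1 d
        _ = 2 ^ (N * d) := by rw [← pow_mul]
        _ ≤ 2 ^ (2 * N ^ 2) := by
          refine pow_le_pow_right₀ (by norm_num) ?_
          nlinarith
    have hsum : ∑ j ∈ Finset.range (2 * K + 1), ((((j : ℤ) - K) ^ d : ℤ) : L) * a j * z ^ j =
        A * ∑ j ∈ Finset.range (2 * K + 1),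
          ((((j : ℤ) - K) ^ d : ℤ) : L) * symCoeff b c K j * z ^ j := by
      rw [Finset.mul_sum]
      refine Finset.sum_congr rfl fun j hj => ?_
      rw [haj j (Nat.lt_succ_iff.mp (Finset.mem_range.mp hj))]
      ring
    have h := one_le_norm_weighted_sum (n := 2 * K) (by omega) ha ha0 hH1 hH hz'
      (w := fun j => ((j : ℤ) - K) ^ d) (one_le_pow₀ (by norm_num)) hW
      (by rw [hsum]; exact mul_ne_zero hAL hne) τ
    rw [hsum, map_mul, norm_mul, map_intCast, Complex.norm_intCast] at h
    set S := ‖τ (∑ j ∈ Finset.range (2 * K + 1),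
          ((((j : ℤ) - K) ^ d : ℤ) : L) * symCoeff b c K j * z ^ j)‖
    have h1 : ((2 : ℝ) ^ (4 * N ^ 2)) ^ (2 * K) ≤ 2 ^ (8 * N ^ 3) := by
      rw [← pow_mul]
      refine pow_le_pow_right₀ (by norm_num) ?_
      nlinarith [Nat.mul_le_mul_left (N ^ 2) hKN.le]
    have h2 : (((2 * K : ℕ) : ℝ) * 2 ^ (4 * N ^ 2)) ^ (2 * K) ≤ 2 ^ (12 * N ^ 3) := by
      calc (((2 * K : ℕ) : ℝ) * 2 ^ (4 * N ^ 2)) ^ (2 * K)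
          ≤ (2 ^ (2 * N) * 2 ^ (4 * N ^ 2)) ^ (2 * K) := by
            gcongr
            linarith
        _ = 2 ^ ((2 * N + 4 * N ^ 2) * (2 * K)) := by rw [← pow_add, ← pow_mul]
        _ ≤ 2 ^ (12 * N ^ 3) := by
          refine pow_le_pow_right₀ (by norm_num) ?_
          calc (2 * N + 4 * N ^ 2) * (2 * K) ≤ (6 * N ^ 2) * (2 * N) := by gcongr; omega
            _ = 12 * N ^ 3 := by ring
    have h3 : (((2 * K : ℕ) : ℝ) + 1) * (2 ^ (2 * N ^ 2) * 2 ^ (4 * N ^ 2) *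
        (((2 * K : ℕ) : ℝ) * 2 ^ (4 * N ^ 2)) ^ (2 * K)) ≤ 2 ^ (20 * N ^ 3) := by
      calc _ ≤ (2 : ℝ) ^ (2 * N) * (2 ^ (2 * N ^ 2) * 2 ^ (4 * N ^ 2) * 2 ^ (12 * N ^ 3)) := by
            gcongr
        _ = 2 ^ (2 * N + (2 * N ^ 2 + 4 * N ^ 2 + 12 * N ^ 3)) := by
            rw [← pow_add, ← pow_add, ← pow_add]
        _ ≤ _ := pow_le_pow_right₀ (by norm_num) (by omega)
    have h4 : ((((2 * K : ℕ) : ℝ) + 1) * (2 ^ (2 * N ^ 2) * 2 ^ (4 * N ^ 2) *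
        (((2 * K : ℕ) : ℝ) * 2 ^ (4 * N ^ 2)) ^ (2 * K))) ^ Module.finrank ℚ L ≤
        2 ^ (20 * N ^ 3 * R) := by
      refine (pow_le_pow_left₀ (by positivity) h3 _).trans ?_
      rw [← pow_mul]
      exact pow_le_pow_right₀ (by norm_num) (by gcongr)
    refine h.trans ?_
    calc _ ≤ 2 ^ (N ^ 2) * S * (2 ^ (8 * N ^ 3) * 2 ^ (20 * N ^ 3 * R)) := by gcongr
      _ = S * 2 ^ (N ^ 2 + (8 * N ^ 3 + 20 * N ^ 3 * R)) := by
          rw [pow_add, pow_add]; ring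
      _ ≤ S * 2 ^ (9 * N ^ 3 + 20 * N ^ 3 * R) := by
          refine mul_le_mul_of_nonneg_left (pow_le_pow_right₀ (by norm_num) ?_) (norm_nonneg _)
          omega
  · intro hne
    have h := one_le_norm_root_add_one (n := 2 * K) (by omega) ha ha0 hH1 hH hz' hne τ
    refine h.trans (mul_le_mul_of_nonneg_left ?_ (norm_nonneg _))
    have h3 : (((2 * K : ℕ) : ℝ) + 1) * 2 ^ (4 * N ^ 2) ≤ 2 ^ (20 * N ^ 3) := by
      calc _ ≤ (2 : ℝ) ^ (2 * N) * 2 ^ (4 * N ^ 2) := by gcongr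
        _ = 2 ^ (2 * N + 4 * N ^ 2) := by rw [← pow_add]
        _ ≤ _ := pow_le_pow_right₀ (by norm_num) (by omega)
    have h1 : (1 : ℝ) ≤ (((2 * K : ℕ) : ℝ) + 1) * 2 ^ (4 * N ^ 2) :=
      one_le_mul_of_one_le_of_one_le (by simp) hH1
    calc _ ≤ (2 : ℝ) ^ (4 * N ^ 2) * (2 ^ (20 * N ^ 3)) ^ R := by
          gcongr
          exact (pow_le_pow_right₀ h1 hR).trans (pow_le_pow_left₀ (by positivity) h3 R)
      _ = 2 ^ (4 * N ^ 2 + 20 * N ^ 3 * R) := by rw [← pow_mul, ← pow_add]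
      _ ≤ _ := pow_le_pow_right₀ (by norm_num) (by omega)

end Bounds

/-! ### Bounds in terms of the encoding length -/

section Encoding

theorem lt_two_pow_length_encodeNat (n : ℕ) : n < 2 ^ (Computability.encodeNat n).length := by
  have hpos : ∀ m : PosNum, (m : ℕ) < 2 ^ (Computability.encodePosNum m).length := by
    intro m
    induction m with
    | one => simp [Computability.encodePosNum]
    | bit1 m ih =>
      rw [Computability.encodePosNum, List.length_cons, pow_succ, PosNum.cast_bit1]
      omega
    | bit0 m ih =>
      rw [Computability.encodePosNum, List.length_cons, pow_succ, PosNum.cast_bit0]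
      omega
  have hnum : ∀ m : Num, (m : ℕ) < 2 ^ (Computability.encodeNum m).length := by
    intro m
    cases m with
    | zero => simp [Computability.encodeNum]
    | pos m => exact hpos m
  simpa [Computability.encodeNat] using hnum (n : Num)

theorem abs_le_two_pow_length_encodeInt (z : ℤ) : |z| ≤ 2 ^ (encodeInt z).length := by
  have h1 : (Computability.encodeNat z.natAbs).length ≤ (encodeInt z).length := by
    have h : ((Computability.encodeNat z.natAbs).flatMap digit).length =
        2 * (Computability.encodeNat z.natAbs).length := by
      simp [List.length_flatMap, digit, mul_comm]
    rw [encodeInt, List.length_append, List.length_append, h]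
    omega
  have h2 := (lt_two_pow_length_encodeNat z.natAbs).le.trans (Nat.pow_le_pow_right two_pos h1)
  rw [Int.abs_eq_natAbs]
  exact_mod_cast h2

theorem length_le_length_flatMap_of_mem {α β : Type*} {l : List α} {f : α → List β} {x : α}
    (hx : x ∈ l) : (f x).length ≤ (l.flatMap f).length := by
  rw [List.length_flatMap]
  exact List.le_sum_of_mem (List.mem_map_of_mem hx)

theorem length_le_length_flatMap {α β : Type*} {l : List α} {f : α → List β}
    (h : ∀ x, 1 ≤ (f x).length) : l.length ≤ (l.flatMap f).length := by
  induction l with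
  | nil => simp
  | cons x l ih =>
    have := h x
    rw [List.flatMap_cons, List.length_append, List.length_cons]
    omega

theorem one_le_length_encodeInt (z : ℤ) : 1 ≤ (encodeInt z).length := by
  simp [encodeInt, digit]

variable (F : FunRep)

theorem length_encodePoly_le_size (m : Fin (F.k + 1)) :
    (encodePoly (F.coeff m).poly).length ≤ F.size := by
  have h : (encodeAlgRep (F.coeff m)).length ≤ F.size :=
    length_le_length_flatMap_of_mem (List.mem_ofFn.mpr ⟨m, rfl⟩)
  refine le_trans ?_ h
  simp only [encodeAlgRep, List.length_append]
  omega

theorem natDegree_le_size (m : Fin (F.k + 1)) : (F.coeff m).poly.natDegree ≤ F.size := by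
  refine le_trans ?_ (length_encodePoly_le_size F m)
  have := length_le_length_flatMap (l := List.range ((F.coeff m).poly.natDegree + 1))
    (f := fun i => encodeInt ((F.coeff m).poly.coeff i)) fun i => one_le_length_encodeInt _
  rw [List.length_range] at this
  rw [encodePoly, List.length_append]
  omega

theorem abs_coeff_le_two_pow_size (m : Fin (F.k + 1)) {i : ℕ}
    (hi : i ≤ (F.coeff m).poly.natDegree) : |(F.coeff m).poly.coeff i| ≤ 2 ^ F.size := by
  refine (abs_le_two_pow_length_encodeInt _).trans (pow_le_pow_right₀ (by norm_num) ?_)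
  refine le_trans ?_ (length_encodePoly_le_size F m)
  have := length_le_length_flatMap_of_mem (f := fun i => encodeInt ((F.coeff m).poly.coeff i))
    (List.mem_range.mpr (Nat.lt_succ_iff.mpr hi))
  rw [encodePoly, List.length_append]
  exact this.trans (Nat.le_add_right _ _)

theorem k_lt_size : F.k < F.size := by
  have := length_le_length_flatMap (l := List.ofFn F.coeff) (f := encodeAlgRep) fun R => by
    have := one_le_length_encodeInt R.re.num
    simp only [encodeAlgRep, encodeRat, List.length_append]
    omega
  rw [List.length_ofFn] at this
  exact this

end Encoding

/-! ### The number field generated by the coefficients and a zero -/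

section NumberField

open IntermediateField

theorem finiteDimensional_adjoin_range {ι : Type*} [Finite ι] {β : ι → ℂ}
    (h : ∀ i, IsIntegral ℚ (β i)) : FiniteDimensional ℚ (adjoin ℚ (Set.range β)) :=
  finiteDimensional_adjoin fun x hx => by
    obtain ⟨i, rfl⟩ := hx
    exact h i

theorem isIntegral_rat_of_aeval_eq_zero {p : Polynomial ℤ} (hp : p ≠ 0) {x : ℂ}
    (hx : Polynomial.aeval x p = 0) : IsIntegral ℚ x := by
  have h : IsAlgebraic ℤ x := ⟨p, hp, hx⟩
  have h' : IsAlgebraic ℚ x := h.extendScalars (algebraMap ℤ ℚ).injective_int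
  exact isAlgebraic_iff_isIntegral.mp h'

/-- Complex conjugation as an automorphism over `ℚ`. -/
noncomputable def conjRat : ℂ →ₐ[ℚ] ℂ := (starRingEnd ℂ).toRatAlgHom

theorem finrank_adjoin_sup_conj_le {ι : Type*} [Finite ι] {β : ι → ℂ}
    (h : ∀ i, IsIntegral ℚ (β i)) {D : ℕ} (hD : Module.finrank ℚ (adjoin ℚ (Set.range β)) ≤ D) :
    FiniteDimensional ℚ ↥(adjoin ℚ (Set.range β) ⊔ (adjoin ℚ (Set.range β)).map conjRat) ∧
    Module.finrank ℚ ↥(adjoin ℚ (Set.range β) ⊔ (adjoin ℚ (Set.range β)).map conjRat) ≤ D ^ 2 := by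
  set E := adjoin ℚ (Set.range β)
  have : FiniteDimensional ℚ E := finiteDimensional_adjoin_range h
  have e := (E.equivMap conjRat).toLinearEquiv
  have : FiniteDimensional ℚ (E.map conjRat) := e.finiteDimensional
  refine ⟨inferInstance, (finrank_sup_le E (E.map conjRat)).trans ?_⟩
  rw [← e.finrank_eq, sq]
  exact Nat.mul_le_mul hD hD

theorem finrank_adjoin_root_le (E : IntermediateField ℚ ℂ) [FiniteDimensional ℚ E] {n : ℕ}
    {a : ℕ → E} {z : ℂ} (h0 : a n ≠ 0)
    (hz : ∑ j ∈ Finset.range (n + 1), (a j : ℂ) * z ^ j = 0) :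
    FiniteDimensional ℚ E⟮z⟯ ∧ Module.finrank ℚ E⟮z⟯ ≤ Module.finrank ℚ E * n := by
  let p : Polynomial E := ∑ j ∈ Finset.range (n + 1), Polynomial.monomial j (a j)
  have hcoeff : p.coeff n = a n := by simp [p, Polynomial.coeff_monomial]
  have hp0 : p ≠ 0 := fun h => h0 (by rw [← hcoeff, h, Polynomial.coeff_zero])
  have hdeg : p.natDegree ≤ n :=
    Polynomial.natDegree_sum_le_of_forall_le _ _ fun j hj =>
      (Polynomial.natDegree_monomial_le _).trans (Nat.lt_succ_iff.mp (Finset.mem_range.mp hj))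
  have hroot : Polynomial.aeval z p = 0 := by
    rw [map_sum, ← hz]
    refine Finset.sum_congr rfl fun j _ => ?_
    rw [Polynomial.aeval_monomial]
    rfl
  have hint : IsIntegral E z := (isAlgebraic_iff_isIntegral).mp ⟨p, hp0, hroot⟩
  have : FiniteDimensional E E⟮z⟯ := adjoin.finiteDimensional hint
  have hfin : FiniteDimensional ℚ E⟮z⟯ := FiniteDimensional.trans ℚ E E⟮z⟯
  refine ⟨hfin, ?_⟩
  rw [← Module.finrank_mul_finrank ℚ E E⟮z⟯, adjoin.finrank hint]
  exact Nat.mul_le_mul_left _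
    ((Polynomial.natDegree_le_of_dvd (minpoly.dvd E z hroot) hp0).trans hdeg)

/-- The bounds of `root_lower_bounds` for complex numbers. -/
theorem complex_root_lower_bounds {N K k D : ℕ} {β : Fin (k + 1) → ℂ} {p : Fin (k + 1) → Polynomial ℤ}
    (hp : ∀ m, p m ≠ 0) (hdeg : ∀ m, (p m).natDegree ≤ N)
    (hcoeff : ∀ m, ∀ i ≤ (p m).natDegree, |(p m).coeff i| ≤ 2 ^ N)
    (hβ : ∀ m, Polynomial.aeval (β m) (p m) = 0)
    (hD : Module.finrank ℚ (adjoin ℚ (Set.range β)) ≤ D)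
    {b : ℕ → ℂ} (hb : ∀ m : Fin (k + 1), b m = β m) (hK : 1 ≤ K) (hKk : K ≤ k) (hkN : k < N)
    (hbK : b K ≠ 0) {a : ℕ → ℂ} (ha : a = symCoeff b (fun m => (starRingEnd ℂ) (b m)) K) {z : ℂ}
    (hz : ∑ j ∈ Finset.range (2 * K + 1), a j * z ^ j = 0) :
    (∀ d ≤ 2 * K, ∑ j ∈ Finset.range (2 * K + 1), (((j : ℤ) - K) ^ d : ℤ) * a j * z ^ j ≠ 0 →
      1 ≤ ‖∑ j ∈ Finset.range (2 * K + 1), (((j : ℤ) - K) ^ d : ℤ) * a j * z ^ j‖ *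
          2 ^ (9 * N ^ 3 + 20 * N ^ 3 * (D ^ 2 * (2 * K)))) ∧
    (z + 1 ≠ 0 → 1 ≤ ‖z + 1‖ * 2 ^ (9 * N ^ 3 + 20 * N ^ 3 * (D ^ 2 * (2 * K)))) ∧
    (∀ j ≤ 2 * K, ‖a j‖ ≤ 2 ^ (2 * N + 1)) := by
  have hint : ∀ m, IsIntegral ℚ (β m) := fun m =>
    isIntegral_rat_of_aeval_eq_zero (hp m) (hβ m)
  obtain ⟨hfin, hrank⟩ := finrank_adjoin_sup_conj_le hint hD
  set E := adjoin ℚ (Set.range β) ⊔ (adjoin ℚ (Set.range β)).map conjRat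
  have hmem : ∀ m, β m ∈ adjoin ℚ (Set.range β) := fun m => subset_adjoin _ _ ⟨m, rfl⟩
  let q : ℕ → Polynomial ℤ := fun m => p (Fin.ofNat (k + 1) m)
  let bE : ℕ → E := fun m => ⟨β (Fin.ofNat (k + 1) m),
    (le_sup_left : adjoin ℚ (Set.range β) ≤ E) (hmem _)⟩
  let cE : ℕ → E := fun m => ⟨(starRingEnd ℂ) (β (Fin.ofNat (k + 1) m)),
    (le_sup_right : (adjoin ℚ (Set.range β)).map conjRat ≤ E) ⟨_, hmem _, rfl⟩⟩
  have hbE : ∀ m ≤ K, (bE m : ℂ) = b m := by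
    intro m hm
    have := hb (Fin.ofNat (k + 1) m)
    rw [Fin.val_ofNat, Nat.mod_eq_of_lt (by omega)] at this
    exact this.symm
  have haE : ∀ j ≤ 2 * K, ((symCoeff bE cE K j : E) : ℂ) = a j := by
    intro j hj
    have h1 := map_symCoeff (algebraMap E ℂ) bE cE K j
    refine h1.trans ?_
    rw [ha]
    unfold symCoeff
    have h2 : ∀ m ≤ K, (algebraMap E ℂ) (bE m) = b m := hbE
    have h3 : ∀ m ≤ K, (algebraMap E ℂ) (cE m) = (starRingEnd ℂ) (b m) := fun m hm =>
      congrArg (starRingEnd ℂ) (hbE m hm)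
    congr 1
    · split_ifs
      · exact h2 _ (by omega)
      · rfl
    · split_ifs
      · exact h3 _ (by omega)
      · rfl
  have hzE : ∑ j ∈ Finset.range (2 * K + 1), ((symCoeff bE cE K j : E) : ℂ) * z ^ j = 0 := by
    rw [← hz]
    refine Finset.sum_congr rfl fun j hj => ?_
    rw [haE j (Nat.lt_succ_iff.mp (Finset.mem_range.mp hj))]
  have hbEK : bE K ≠ 0 := fun h => hbK (by rw [← hbE K le_rfl, h]; rfl)
  obtain ⟨hfinL, hrankL⟩ := finrank_adjoin_root_le E (a := symCoeff bE cE K) (n := 2 * K)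
    (by rw [symCoeff_two_mul _ _ hK]; exact hbEK) hzE
  have : NumberField E⟮z⟯ := { to_finiteDimensional := hfinL }
  let zL : E⟮z⟯ := ⟨z, mem_adjoin_simple_self E z⟩
  let ι : E →+* E⟮z⟯ := algebraMap E E⟮z⟯
  let τ : E⟮z⟯ →+* ℂ := algebraMap E⟮z⟯ ℂ
  have hτι : ∀ x : E, τ (ι x) = x := fun x => rfl
  have hτa : ∀ j ≤ 2 * K, τ (symCoeff (fun m => ι (bE m)) (fun m => ι (cE m)) K j) = a j := by
    intro j hj
    rw [← map_symCoeff ι, hτι, haE j hj]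
  have haeval : ∀ (x : E) (r : Polynomial ℤ), Polynomial.aeval (x : ℂ) r = 0 →
      Polynomial.aeval (ι x) r = 0 := by
    intro x r hr
    refine (map_eq_zero_iff τ τ.injective).mp ?_
    have := Polynomial.aeval_algHom_apply τ.toIntAlgHom (ι x) r
    exact this.symm.trans hr
  have hq : ∀ m, Polynomial.aeval (bE m : ℂ) (q m) = 0 := fun m => hβ _
  have hq' : ∀ m, Polynomial.aeval (cE m : ℂ) (q m) = 0 := by
    intro m
    have := Polynomial.aeval_algHom_apply (starRingEnd ℂ).toIntAlgHom (bE m : ℂ) (q m)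
    rw [hq, map_zero] at this
    exact this
  have hzL : ∑ j ∈ Finset.range (2 * K + 1),
      symCoeff (fun m => ι (bE m)) (fun m => ι (cE m)) K j * zL ^ j = 0 := by
    refine (map_eq_zero_iff τ τ.injective).mp ?_
    rw [map_sum, ← hz]
    refine Finset.sum_congr rfl fun j hj => ?_
    rw [map_mul, hτa j (Nat.lt_succ_iff.mp (Finset.mem_range.mp hj)), map_pow]
    rfl
  have hsum : ∀ d : ℕ, τ (∑ j ∈ Finset.range (2 * K + 1), ((((j : ℤ) - K) ^ d : ℤ) : E⟮z⟯) *
      symCoeff (fun m => ι (bE m)) (fun m => ι (cE m)) K j * zL ^ j) =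
      ∑ j ∈ Finset.range (2 * K + 1), (((j : ℤ) - K) ^ d : ℤ) * a j * z ^ j := by
    intro d
    rw [map_sum]
    refine Finset.sum_congr rfl fun j hj => ?_
    rw [map_mul, map_mul, hτa j (Nat.lt_succ_iff.mp (Finset.mem_range.mp hj)), map_pow, map_intCast]
    rfl
  have hR : Module.finrank ℚ E⟮z⟯ ≤ D ^ 2 * (2 * K) := hrankL.trans (Nat.mul_le_mul_right _ hrank)
  have hb0 : ∀ m ≤ K, Polynomial.aeval (ι (bE m)) (q m) = 0 := fun m _ => haeval _ _ (hq m)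
  have hc0 : ∀ m ≤ K, Polynomial.aeval (ι (cE m)) (q m) = 0 := fun m _ => haeval _ _ (hq' m)
  have main := root_lower_bounds (N := N) (K := K) (p := q) (b := fun m => ι (bE m))
    (c := fun m => ι (cE m)) (z := zL) hK (hKk.trans_lt hkN) (fun m _ => hp _) (fun m _ => hdeg _)
    (fun m _ => hcoeff _) hb0 hc0 (fun h => hbEK (ι.injective (by rw [h, map_zero]))) hzL
    (by convert! hR) τ
  refine ⟨fun d hd hne => ?_, fun hne => ?_, fun j hj => ?_⟩
  · have := main.1 d hd (fun h => hne (by rw [← hsum d, h, map_zero]))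
    rwa [hsum d] at this
  · exact main.2 fun h => hne (congrArg τ h)
  · rw [← hτa j hj]
    exact norm_embedding_symCoeff_le (p := q) (fun m _ => hp _) (fun m _ => hdeg _)
      (fun m _ => hcoeff _) hb0 hc0 hj τ

end NumberField

/-! ### The main estimate -/

section Main

open Complex

theorem Ioo_subset_of_dist_neg_one {φ ε : ℝ} (hφ : φ ∈ Set.Ioc (-Real.pi) Real.pi)
    (h : ε ≤ ‖exp (φ * I) + 1‖) :
    Set.Ioo (φ - ε) (φ + ε) ⊆ Set.Ioo (-Real.pi) Real.pi := by
  have key : ∀ t : ℝ, exp (t * I) = -1 → ‖exp (φ * I) + 1‖ ≤ |φ - t| := by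
    intro t ht
    have h1 : exp (φ * I) + 1 = exp (φ * I) - exp (t * I) := by rw [ht]; ring
    have h2 : exp (φ * I) - exp (t * I) = exp (t * I) * (exp (I * (φ - t : ℝ)) - 1) := by
      rw [mul_sub, mul_one, ← exp_add]
      congr 2
      push_cast
      ring
    rw [h1, h2, norm_mul, norm_exp_ofReal_mul_I, one_mul]
    exact Real.norm_exp_I_mul_ofReal_sub_one_le
  have h1 := key Real.pi exp_pi_mul_I
  have h2 := key (-Real.pi) (by
    rw [ofReal_neg, neg_mul, exp_neg, exp_pi_mul_I]; norm_num)
  rw [abs_of_nonpos (by linarith [hφ.2])] at h1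
  rw [abs_of_nonneg (by linarith [hφ.1])] at h2
  intro x hx
  exact ⟨by linarith [hx.1], by linarith [hx.2]⟩

theorem goodRadius_of_le_two_pow {N k D : ℕ} {β : Fin (k + 1) → ℂ} {p : Fin (k + 1) → Polynomial ℤ}
    (hp : ∀ m, p m ≠ 0) (hdeg : ∀ m, (p m).natDegree ≤ N)
    (hcoeff : ∀ m, ∀ i ≤ (p m).natDegree, |(p m).coeff i| ≤ 2 ^ N)
    (hβ : ∀ m, Polynomial.aeval (β m) (p m) = 0)
    (hD : Module.finrank ℚ (IntermediateField.adjoin ℚ (Set.range β)) ≤ D) (hkN : k < N)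
    (hne : ∃ m : Fin (k + 1), 1 ≤ (m : ℕ) ∧ β m ≠ 0) {φ ε : ℝ}
    (hφ : φ ∈ Set.Ioc (-Real.pi) Real.pi) (h0 : circleFun β φ = 0)
    (hε : ε * 2 ^ (62 * (D ^ 2 + 1) * N ^ 4) ≤ 1) :
    GoodRadius (circleFun β) φ ε ∧
      (φ < Real.pi → Set.Ioo (φ - ε) (φ + ε) ⊆ Set.Ioo (-Real.pi) Real.pi) := by
  classical
  let b : ℕ → ℂ := fun m => if h : m < k + 1 then β ⟨m, h⟩ else 0
  have hb : ∀ m : Fin (k + 1), b m = β m := fun m => dif_pos m.2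
  obtain ⟨m₀, hm₀, hβm₀⟩ := hne
  set K := Nat.findGreatest (fun m => b m ≠ 0) k with hKdef
  have hm₀k : (m₀ : ℕ) ≤ k := Nat.lt_succ_iff.mp m₀.2
  have hbm₀ : b m₀ ≠ 0 := by rwa [hb]
  have hK : 1 ≤ K := hm₀.trans (Nat.le_findGreatest hm₀k hbm₀)
  have hKk : K ≤ k := Nat.findGreatest_le k
  have hbK : b K ≠ 0 := Nat.findGreatest_spec (P := fun m => b m ≠ 0) hm₀k hbm₀
  have hbgt : ∀ m, K < m → b m = 0 := by
    intro m hm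
    by_cases hmk : m ≤ k
    · exact not_not.mp (Nat.findGreatest_is_greatest hm hmk)
    · exact dif_neg (by omega)
  obtain ⟨a, ha⟩ : ∃ a, a = symCoeff b (fun m => (starRingEnd ℂ) (b m)) K := ⟨_, rfl⟩
  have hcirc : ∀ x, (circleFun β x : ℂ) = trigSum a K 0 x := by
    intro x
    rw [ha]
    exact coe_circleFun_eq_trigSum hKk β b hb hbgt x
  have hreal : ∀ n x, ((trigSum a K n x).re : ℂ) = trigSum a K n x :=
    ofReal_re_trigSum fun x => by rw [← hcirc, ofReal_re]
  have hf : ∀ n x, HasDerivAt (fun y => (trigSum a K n y).re) (trigSum a K (n + 1) x).re x := by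
    intro n x
    simpa using! (Complex.reCLM.hasFDerivAt.comp_hasDerivAt x (hasDerivAt_trigSum a K n x))
  have hf0 : circleFun β = fun y => (trigSum a K 0 y).re := by
    funext y
    rw [← hcirc, ofReal_re]
  have habs : ∀ n x, |(trigSum a K n x).re| = ‖trigSum a K n x‖ := by
    intro n x
    rw [← hreal n x, ofReal_re, norm_real, Real.norm_eq_abs]
  have hroot : ∑ j ∈ Finset.range (2 * K + 1), a j * exp (φ * I) ^ j = 0 := by
    have h := trigSum_eq a K 0 φ
    rw [← hcirc, h0] at h
    simpa using h.symm
  have haK : a (2 * K) ≠ 0 := by rwa [ha, symCoeff_two_mul _ _ hK]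
  obtain ⟨hlow, hdist, hanorm⟩ := complex_root_lower_bounds hp hdeg hcoeff hβ hD hb hK hKk hkN hbK
    ha hroot
  have hex : ∃ n, trigSum a K n φ ≠ 0 := (exists_trigSum_ne_zero haK φ).imp fun _ h => h.2
  set d := Nat.find hex with hd_def
  have hdne : trigSum a K d φ ≠ 0 := Nat.find_spec hex
  have hdK : d ≤ 2 * K := by
    obtain ⟨n, hn, hn'⟩ := exists_trigSum_ne_zero haK φ
    exact (Nat.find_min' hex hn').trans hn
  have hdlt : ∀ j < d, trigSum a K j φ = 0 := fun j hj => not_not.mp (Nat.find_min hex hj)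
  have hd1 : 1 ≤ d := by
    by_contra h
    refine hdne ?_
    rw [show d = 0 by omega, ← hcirc, h0, ofReal_zero]
  set Q := 9 * N ^ 3 + 20 * N ^ 3 * (D ^ 2 * (2 * K)) with hQ
  have hlow' : 1 ≤ ‖trigSum a K d φ‖ * 2 ^ Q := by
    rw [norm_trigSum_eq]
    refine hlow d hdK fun h => hdne ?_
    rw [← norm_eq_zero, norm_trigSum_eq, h, norm_zero]
  have hN : 1 ≤ N := by omega
  have hexp : Q + 13 * N ^ 2 ≤ 62 * (D ^ 2 + 1) * N ^ 4 := by
    have h34 : N ^ 3 ≤ N ^ 4 := Nat.pow_le_pow_right hN (by norm_num)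
    have h24 : N ^ 2 ≤ N ^ 4 := Nat.pow_le_pow_right hN (by norm_num)
    have h1 : 20 * N ^ 3 * (D ^ 2 * (2 * K)) ≤ 20 * N ^ 3 * (D ^ 2 * (2 * N)) := by
      gcongr
      omega
    have h2 : 20 * N ^ 3 * (D ^ 2 * (2 * N)) = 40 * (D ^ 2 * N ^ 4) := by ring
    have h3 : 62 * (D ^ 2 + 1) * N ^ 4 = 62 * (D ^ 2 * N ^ 4) + 62 * N ^ 4 := by ring
    omega
  constructor
  · rw [hf0]
    refine goodRadius_of_bounds (f := fun n y => (trigSum a K n y).re) hf hd1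
      (M := (2 * K + 1) * (2 ^ (2 * N + 1) * K ^ (d + 1)))
      (fun x => by rw [habs]; exact norm_trigSum_le hanorm (d + 1) x)
      (fun j hj => by rw [hdlt j hj, zero_re])
      (fun h => hdne (by rw [← hreal, h, ofReal_zero])) ?_
    rw [habs]
    have hK2 : (K : ℝ) ≤ 2 ^ N := by
      exact_mod_cast (hKk.trans hkN.le).trans Nat.lt_two_pow_self.le
    have hK3 : (2 * K + 1 : ℝ) ≤ 2 ^ (2 * N) := by
      have : 2 * K + 1 ≤ 2 ^ (2 * N) := (by omega : 2 * K + 1 ≤ 2 * N).trans Nat.lt_two_pow_self.le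
      exact_mod_cast this
    have hfac : (d.factorial : ℝ) ≤ 2 ^ (4 * N ^ 2) := by
      have h1 : d.factorial ≤ d ^ d := Nat.factorial_le_pow d
      have h2 : d ^ d ≤ (2 ^ (2 * N)) ^ (2 * N) :=
        (Nat.pow_le_pow_left ((by omega : d ≤ 2 * N).trans Nat.lt_two_pow_self.le) d).trans
          (Nat.pow_le_pow_right (by positivity) (by omega))
      have h3 : (2 ^ (2 * N)) ^ (2 * N) = 2 ^ (4 * N ^ 2) := by rw [← pow_mul]; congr 1; ring
      exact_mod_cast (h1.trans h2).trans h3.le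
    have hKd : (K : ℝ) ^ (d + 1) ≤ 2 ^ (3 * N ^ 2) := by
      calc (K : ℝ) ^ (d + 1) ≤ (2 ^ N) ^ (d + 1) := by gcongr
        _ = 2 ^ (N * (d + 1)) := by rw [← pow_mul]
        _ ≤ 2 ^ (3 * N ^ 2) := by
          refine pow_le_pow_right₀ (by norm_num) ?_
          have : d + 1 ≤ 3 * N := by omega
          nlinarith
    rcases le_or_gt ε 0 with hε0 | hε0
    · refine le_trans (mul_nonpos_of_nonneg_of_nonpos (by positivity) hε0) (norm_nonneg _)
    have hM : 2 * (d.factorial : ℝ) * ((2 * K + 1) * (2 ^ (2 * N + 1) * K ^ (d + 1))) ≤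
        2 ^ (13 * N ^ 2) := by
      calc _ ≤ 2 * (2 : ℝ) ^ (4 * N ^ 2) * (2 ^ (2 * N) * (2 ^ (2 * N + 1) * 2 ^ (3 * N ^ 2))) := by
            gcongr
        _ = 2 ^ (1 + 4 * N ^ 2 + (2 * N + (2 * N + 1 + 3 * N ^ 2))) := by
            rw [pow_add, pow_add, pow_add, pow_add]; ring
        _ ≤ 2 ^ (13 * N ^ 2) := by
            refine pow_le_pow_right₀ (by norm_num) ?_
            nlinarith
    have h1 : 2 ^ (13 * N ^ 2) * ε * 2 ^ Q ≤ 1 := by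
      refine le_trans ?_ hε
      calc 2 ^ (13 * N ^ 2) * ε * 2 ^ Q = ε * 2 ^ (Q + 13 * N ^ 2) := by rw [pow_add]; ring
        _ ≤ _ := by
          gcongr
          norm_num
    calc _ ≤ 2 ^ (13 * N ^ 2) * ε := by gcongr
      _ ≤ ‖trigSum a K d φ‖ := le_of_mul_le_mul_right (h1.trans hlow') (by positivity)
  · intro hlt
    refine Ioo_subset_of_dist_neg_one hφ ?_
    have hz : exp (φ * I) + 1 ≠ 0 := by
      intro h
      have h1 : exp (φ * I) = exp (Real.pi * I) := by
        rw [exp_pi_mul_I]; linear_combination h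
      have h2 := congrArg arg h1
      rw [arg_exp_mul_I, arg_exp_mul_I, (toIocMod_eq_self Real.two_pi_pos).mpr,
        (toIocMod_eq_self Real.two_pi_pos).mpr] at h2
      · exact hlt.ne h2
      · exact ⟨by linarith [Real.pi_pos], by linarith⟩
      · exact ⟨hφ.1, by linarith [hφ.2]⟩
    have h1 := hdist hz
    rcases le_or_gt ε 0 with hε0 | hε0
    · exact hε0.trans (norm_nonneg _)
    refine le_of_mul_le_mul_right (le_trans ?_ h1) (by positivity : (0 : ℝ) < 2 ^ Q)
    refine le_trans ?_ hε
    gcongr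
    · norm_num
    · omega

end Main

end DominantFunction

theorem mainTheorem5 (D : ℕ) :
    ∃ (ε : DominantFunction.FunRep → ℚ) (C : ℕ),
      Nonempty (Turing.TM2ComputableInPolyTime
        DominantFunction.encodeFun DominantFunction.encodeRat ε) ∧
      ∀ (F : DominantFunction.FunRep) (β : Fin (F.k + 1) → ℂ),
        (∀ m, (F.coeff m).Represents (β m)) →
        Module.finrank ℚ (IntermediateField.adjoin ℚ (Set.range β)) ≤ D →
        (∃ m : Fin (F.k + 1), 1 ≤ (m : ℕ) ∧ β m ≠ 0) →
        0 < ε F ∧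
        1 / ε F ≤ 2 ^ (F.size ^ C) ∧
        ∀ φ ∈ Set.Ioc (-Real.pi) Real.pi, DominantFunction.circleFun β φ = 0 →
          DominantFunction.GoodRadius (DominantFunction.circleFun β) φ (ε F) ∧
          (φ < Real.pi →
            Set.Ioo (φ - (ε F : ℝ)) (φ + (ε F : ℝ)) ⊆ Set.Ioo (-Real.pi) Real.pi) := by
  refine ⟨fun F => 1 / 2 ^ (F.size ^ (62 * (D ^ 2 + 1) + 4)), 62 * (D ^ 2 + 1) + 4,
    ⟨DominantFunction.invTwoPowComputable _⟩, fun F β hβ hD hne => ⟨by positivity, by simp, ?_⟩⟩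
  intro φ hφ h0
  have hk := DominantFunction.k_lt_size F
  have hN : 2 ≤ F.size := by
    obtain ⟨m, hm, -⟩ := hne
    have := m.2
    omega
  refine DominantFunction.goodRadius_of_le_two_pow (p := fun m => (F.coeff m).poly)
    (fun m => (hβ m).1.1) (fun m => DominantFunction.natDegree_le_size F m)
    (fun m i hi => DominantFunction.abs_coeff_le_two_pow_size F m hi)
    (fun m => (hβ m).1.2.2.1) hD hk hne hφ h0 ?_
  have hpow : 62 * (D ^ 2 + 1) * F.size ^ 4 ≤ F.size ^ (62 * (D ^ 2 + 1) + 4) := by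
    rw [pow_add]
    refine Nat.mul_le_mul_right _ (Nat.lt_two_pow_self.le.trans (Nat.pow_le_pow_left hN _))
  push_cast
  rw [one_div, inv_mul_le_one₀ (by positivity)]
  exact pow_le_pow_right₀ (by norm_num) hpow
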